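/- Let $\sigma_x,\sigma_y,\sigma_z$ be the Pauli matrices. For a finite nonempty set $V=\{n_1,\dots,n_N\}$ of unit vectors in $\mathbb R^3$ with $\sum_j n_j=0$, consider the qubit POVMs $$\Big\{\tfrac1N\big(\mathbf 1+(Rn_j)\cdot\vec\sigma\big) : j=1,\dots,N\Big\},\qquad R\in SO(3).$$ A frame function for $V$ is a function $f$ from the effects occurring in these POVMs to $[0,1]$ whose values sum to $1$ on each of these POVMs and for which $F(n)=f\big(\tfrac1N(\mathbf 1+n\cdot\vec\sigma)\big)$ is continuous on the unit sphere $S^2$. Let $Y_{lm}$ be the standard (orthonormal) spherical harmonics and $c_{lm}=\int_{S^2}\overline{Y_{lm}}\,F\,d\Omega$ the expansion coefficients of $F$. The $l$-th harmonic is called allowed for $V$ if some frame function for $V$ has $c_{lm}\neq0$ for some $m$ with $-l\le m\le l$. 1. If $V$ is the set of vertices of a regular octahedron, or of a cube, inscribed in $S^2$, then the sets above are indeed POVMs, $V$ consists of antipodal pairs, the projectors onto the vectors of $V$ sum to a multiple of the $3\times3$ identity, and the allowed harmonics for $V$ are exactly $l=0$, $l=2$ and all odd $l$. 2. For every $V$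 as in the first paragraph: if $-n\in V$ for every $n\in V$, then all odd harmonics are allowed; if $\sum_{n\in V} n n^{T}$ is a multiple of the identity, then $l=2$ is allowed; and if $l\ge1$ and $\sum_{n\in V}Y_{ll}(n)\ne0$, then the $l$-th harmonic is not allowed. 3. For the octahedron with vertices $\pm e_x$ and $(\pm e_y\pm e_z)/\sqrt2$ (all four sign choices), and for the cube whose vertices are $$e_x,\quad -\tfrac13e_x-\tfrac{2\sqrt2}{3}e_z,\quad -\tfrac13e_x+\tfrac{\sqrt2}{3}e_z\pm\sqrt{\tfrac23}\,e_y$$ and their antipodal points, the sum of $Y_{ll}$ over the vertices is nonzero for every even $l\ge4$. -/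

import Mathlib

open scoped ComplexConjugate ComplexOrder Nat
open MeasureTheory

noncomputable section

namespace QubitFrame

/-- Euclidean three-space. -/
abbrev E3 : Type := EuclideanSpace ℝ (Fin 3)

/-- The unit (Bloch) sphere in three-space. -/
abbrev S2 : Type := Metric.sphere (0 : E3) 1

/-- Operators on a qubit. -/
abbrev Op : Type := Matrix (Fin 2) (Fin 2) ℂ

def pauliX : Op := !![0, 1; 1, 0]

def pauliY : Op := !![0, -Complex.I; Complex.I, 0]

def pauliZ : Op := !![1, 0; 0, -1]

/-- The effect `(1/N) (1 + n · σ)` with Bloch direction `n`. -/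
def effect (N : ℕ) (n : S2) : Op :=
  (N : ℂ)⁻¹ • (1 + (n.1 0 : ℂ) • pauliX + (n.1 1 : ℂ) • pauliY + (n.1 2 : ℂ) • pauliZ)

/-- A finite set of operators is a POVM: all are positive and they sum to the identity. -/
def IsPOVM (X : Finset Op) : Prop :=
  (∀ E ∈ X, E.PosSemidef) ∧ ∑ E ∈ X, E = 1

/-- The point `R n` of the sphere. -/
def rotate (R : E3 ≃ₗᵢ[ℝ] E3) (n : S2) : S2 :=
  ⟨R n.1, by simp⟩

open Classical in
/-- The rotationally invariant set of measurements generated by the unit vectors in `V`: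
for each proper rotation `R`, the measurement with effects `(1/N) (1 + (R n) · σ)`, `n ∈ V`,
where `N` is the number of vectors in `V`. -/
def restrictedPOVMs (V : Finset S2) : Set (Finset Op) :=
  {X | ∃ R : E3 ≃ₗᵢ[ℝ] E3, LinearMap.det (R.toLinearEquiv : E3 →ₗ[ℝ] E3) = 1 ∧
    X = V.image (fun n => effect V.card (rotate R n))}

/-- A frame function on a set `S` of POVMs: it assigns a number in `[0,1]` to each effect occurring
in some member of `S`, with total `1` on every member of `S`.
Values of `f` at all other operators play no role. -/
def IsFrameFunction (S : Set (Finset Op)) (f : Op → ℝ) : Prop :=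
  (∀ X ∈ S, ∀ E ∈ X, f E ∈ Set.Icc (0 : ℝ) 1) ∧ ∀ X ∈ S, ∑ E ∈ X, f E = 1

/-- The function `F(n) = f ((1/N) (1 + n · σ))` on the sphere. -/
def blochFunction (N : ℕ) (f : Op → ℝ) (n : S2) : ℝ :=
  f (effect N n)

/-- The polynomial `p` with `P_l^m(x) = (1 - x^2)^(m/2) p(x)`, where `P_l^m` (`m ≥ 0`) is the
associated Legendre function with the Condon-Shortley phase:
`p = (-1)^m / (2^l l!) * (d/dx)^(l+m) (x^2 - 1)^l`. -/
def legendreFactor (l m : ℕ) : Polynomial ℝ :=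
  Polynomial.C ((-1) ^ m / (2 ^ l * (l ! : ℝ))) *
    Polynomial.derivative^[l + m] ((Polynomial.X ^ 2 - 1) ^ l)

/-- The spherical harmonic `Y_{lm}` for `0 ≤ m ≤ l`. On the unit sphere
`(1 - n_z^2)^(m/2) e^{imφ} = (n_x + i n_y)^m`. -/
def sphericalHarmonicNonneg (l m : ℕ) (n : S2) : ℂ :=
  ((Real.sqrt ((2 * (l : ℝ) + 1) / (4 * Real.pi) * (((l - m) ! : ℝ) / ((l + m) ! : ℝ))) *
    (legendreFactor l m).eval (n.1 2) : ℝ) : ℂ) * ((n.1 0 : ℂ) + Complex.I * (n.1 1 : ℂ)) ^ m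

/-- The spherical harmonic `Y_{lm}`, `-l ≤ m ≤ l`, with `Y_{l,-m} = (-1)^m conj Y_{lm}`. -/
def sphericalHarmonic (l : ℕ) (m : ℤ) (n : S2) : ℂ :=
  if 0 ≤ m then sphericalHarmonicNonneg l m.natAbs n
  else (-1) ^ m.natAbs * conj (sphericalHarmonicNonneg l m.natAbs n)

/-- The coefficient `c_{lm} = ∫ conj Y_{lm} F dΩ` of `Y_{lm}` in the expansion of `F`; here
`volume.toSphere` is the surface measure of the unit sphere, of total mass `4π`. -/
def harmonicCoeff (F : S2 → ℝ) (l : ℕ) (m : ℤ) : ℂ :=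
  ∫ n : S2, conj (sphericalHarmonic l m n) * (F n : ℂ) ∂((volume : Measure E3).toSphere)

/-- The degrees `l` of the harmonics allowed in (continuous) frame functions on the restricted set
of POVMs generated by `V`: some such frame function has a nonzero coefficient of degree `l`. -/
def allowedHarmonics (V : Finset S2) : Set ℕ :=
  {l | ∃ f : Op → ℝ, IsFrameFunction (restrictedPOVMs V) f ∧
    Continuous (blochFunction V.card f) ∧
    ∃ m : ℤ, -(l : ℤ) ≤ m ∧ m ≤ l ∧ harmonicCoeff (blochFunction V.card f) l m ≠ 0}

/-- `V` is the set of six vertices `± b_i` of a regular octahedron inscribed in the sphere. -/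
def IsOctahedron (V : Finset S2) : Prop :=
  ∃ b : OrthonormalBasis (Fin 3) ℝ E3, ∀ n : S2, n ∈ V ↔ ∃ i, n.1 = b i ∨ n.1 = -b i

/-- `V` is the set of eight vertices `(± b_0 ± b_1 ± b_2) / √3` of a cube inscribed in the
sphere. -/
def IsCube (V : Finset S2) : Prop :=
  ∃ b : OrthonormalBasis (Fin 3) ℝ E3, ∀ n : S2, n ∈ V ↔
    ∃ s : Fin 3 → ℝ, (∀ i, s i = 1 ∨ s i = -1) ∧ n.1 = (Real.sqrt 3)⁻¹ • ∑ i, s i • b i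

/-- The vectors come in antipodal pairs. -/
def IsAntipodal (V : Finset S2) : Prop :=
  ∀ n ∈ V, -n ∈ V

/-- The projectors onto the vectors sum to a multiple of the identity on three-space. -/
def ProjectorsSumToScalar (V : Finset S2) : Prop :=
  ∃ c : ℝ, ∑ n ∈ V, Matrix.vecMulVec (n.1 : Fin 3 → ℝ) (n.1 : Fin 3 → ℝ) =
    c • (1 : Matrix (Fin 3) (Fin 3) ℝ)

/-- The vectors `± e_x` together with the four quadrant directions `(± e_y ± e_z) / √2`. -/
def fiducialOctahedron : Set E3 :=
  {!₂[1, 0, 0], !₂[-1, 0, 0],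
    !₂[0, (Real.sqrt 2)⁻¹, (Real.sqrt 2)⁻¹], !₂[0, (Real.sqrt 2)⁻¹, -(Real.sqrt 2)⁻¹],
    !₂[0, -(Real.sqrt 2)⁻¹, (Real.sqrt 2)⁻¹], !₂[0, -(Real.sqrt 2)⁻¹, -(Real.sqrt 2)⁻¹]}

/-- The regular tetrahedron with vertices `e_x`, `-e_x/3 - (2√2/3) e_z`,
`-e_x/3 + (√2/3) e_z ± √(2/3) e_y`. -/
def fiducialTetrahedron : Set E3 :=
  {!₂[1, 0, 0], !₂[-1 / 3, 0, -(2 * Real.sqrt 2 / 3)],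
    !₂[-1 / 3, Real.sqrt (2 / 3), Real.sqrt 2 / 3],
    !₂[-1 / 3, -Real.sqrt (2 / 3), Real.sqrt 2 / 3]}

/-- The tetrahedron above together with its antipodal points. -/
def fiducialCube : Set E3 :=
  {v | v ∈ fiducialTetrahedron ∨ -v ∈ fiducialTetrahedron}

end QubitFrame

end

/-! Exclusion of a degree rests on powers of isotropic linear forms: for a complex vector `w` with
`w · w = 0`, the function `(w · n)^l` is harmonic of degree `l`. For a frame function `F` and
isotropic `v`, `w`, consider the average over rotations `g` of `F(g n) (v · g w)^l` (`pairing`). It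
does not change when `n` and `w` are rotated together, so it may be averaged over the stabilizer of
`n`. For isotropic vectors that average turns `(v · g w)^l` into a constant times `(v · g n)^l (w ·
n)^l`; finitely many rotations about the axis suffice, which makes it an identity about roots of
unity. Hence the pairing is `(w · n)^l` times a constant independent of `n` and `w` (`pairing_eq`).

Now sum over `n ∈ V`. Since the values `F(g n)` sum to 1, the total is the pairing of the function
1, which vanishes for `l ≥ 1`. So if `∑ (w · n)^l ≠ 0` over `V` for a single isotropic `w`, then `F`
is orthogonal to `(v · n)^l` for every isotropic `v` (`integral_mul_isotropic_pow_eq_zero`). All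
`Y_{lm}` of degree `l` are, up to scalars and conjugation, coefficients of a generating polynomial
whose values are such powers, so every `c_{lm}` vanishes. The form `x + i y` gives the criterion
with `Y_{ll}`.

Conversely `(1 + Re (x + i y)^l) / N` is a frame function as soon as the real parts cancel over
every rotated copy of `V` (`mem_allowedHarmonics`): for odd `l` by antipodality, for `l = 2` because
the projectors sum to a scalar.

For the octahedron and the cube, an isotropic form adapted to the axes has explicit values on the
vertices, and elementary estimates show that its even power sums are nonzero from degree 4 on. -/

noncomputable section

namespace QubitFrame

/-! ### The compact group SO(3) and its action on the sphere -/

/-- The rotation group in three dimensions, as a group of matrices. -/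
abbrev SO3 : Type := Matrix.specialUnitaryGroup (Fin 3) ℝ

namespace SO3

instance : MeasurableSpace SO3 := borel SO3

instance : BorelSpace SO3 := ⟨rfl⟩

instance : IsTopologicalGroup SO3 where
  continuous_inv := by
    refine Continuous.subtype_mk (f := fun g : SO3 => star g.1) ?_ _
    exact continuous_subtype_val.star

instance : CompactSpace SO3 := by
  refine isCompact_iff_compactSpace.1
    (?_ : IsCompact (Matrix.specialUnitaryGroup (Fin 3) ℝ : Set (Matrix (Fin 3) (Fin 3) ℝ)))
  have hK : IsCompact (Set.univ.pi fun _ : Fin 3 => Set.univ.pi fun _ : Fin 3 =>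
      Set.Icc (-1 : ℝ) 1) :=
    isCompact_univ_pi fun _ => isCompact_univ_pi fun _ => isCompact_Icc
  refine IsCompact.of_isClosed_subset hK ?_ ?_
  · have h : (Matrix.specialUnitaryGroup (Fin 3) ℝ : Set (Matrix (Fin 3) (Fin 3) ℝ)) =
        {A | A * star A = 1} ∩ {A | A.det = 1} := by
      ext A
      simp [Matrix.mem_specialUnitaryGroup_iff, Matrix.mem_unitaryGroup_iff]
    rw [h]
    refine IsClosed.inter ?_ ?_
    · exact isClosed_eq (continuous_id.mul continuous_id.star) continuous_const
    · exact isClosed_eq continuous_id.matrix_det continuous_const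
  · intro A hA i _ j _
    have := entry_norm_bound_of_unitary hA.1 i j
    rwa [Real.norm_eq_abs, abs_le] at this

theorem transpose_mul_self (g : SO3) : g.1.transpose * g.1 = 1 := by
  have := Matrix.mem_unitaryGroup_iff'.1 g.2.1
  rwa [Matrix.star_eq_conjTranspose, Matrix.conjTranspose_eq_transpose_of_trivial] at this

theorem mul_transpose_self (g : SO3) : g.1 * g.1.transpose = 1 := by
  have := Matrix.mem_unitaryGroup_iff.1 g.2.1
  rwa [Matrix.star_eq_conjTranspose, Matrix.conjTranspose_eq_transpose_of_trivial] at this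

theorem det_eq_one (g : SO3) : g.1.det = 1 := (Matrix.mem_specialUnitaryGroup_iff.1 g.2).2

/-- An orthogonal matrix of determinant one as a rotation. -/
def mk (A : Matrix (Fin 3) (Fin 3) ℝ) (hA : A * A.transpose = 1) (hd : A.det = 1) : SO3 :=
  ⟨A, Matrix.mem_specialUnitaryGroup_iff.2 ⟨Matrix.mem_unitaryGroup_iff.2 (by
    rwa [Matrix.star_eq_conjTranspose, Matrix.conjTranspose_eq_transpose_of_trivial]), hd⟩⟩

/-- The linear isometry of three-space given by a rotation matrix. -/
def toIsometry (g : SO3) : E3 ≃ₗᵢ[ℝ] E3 :=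
  LinearEquiv.isometryOfInner
    (LinearEquiv.ofLinearMap (Matrix.toLpLin 2 2 g.1) (Matrix.toLpLin 2 2 g.1.transpose)
      (by rw [← Matrix.toLpLin_mul_same, mul_transpose_self, Matrix.toLpLin_one])
      (by rw [← Matrix.toLpLin_mul_same, transpose_mul_self, Matrix.toLpLin_one]))
    (by
      intro x y
      simp only [LinearEquiv.coe_ofLinearMap, Matrix.toLpLin_apply,
        EuclideanSpace.inner_eq_star_dotProduct, star_trivial]
      rw [Matrix.dotProduct_mulVec, Matrix.vecMul_mulVec, transpose_mul_self, Matrix.vecMul_one])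

theorem det_toIsometry (g : SO3) :
    LinearMap.det (g.toIsometry.toLinearEquiv : E3 →ₗ[ℝ] E3) = 1 := by
  have : (g.toIsometry.toLinearEquiv : E3 →ₗ[ℝ] E3) = Matrix.toLpLin 2 2 g.1 := rfl
  rw [this, Matrix.toLpLin_eq_toLin, LinearMap.det_toLin, det_eq_one]

/-- The action of a rotation on the unit sphere. -/
def act (g : SO3) (n : S2) : S2 := rotate g.toIsometry n

theorem act_ofLp (g : SO3) (n : S2) : (g.act n).1.ofLp = g.1.mulVec n.1.ofLp := rfl

theorem act_mul (g h : SO3) (n : S2) : (g * h).act n = g.act (h.act n) := by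
  apply Subtype.ext
  apply (WithLp.ofLp_injective 2)
  rw [act_ofLp, act_ofLp, act_ofLp, Matrix.mulVec_mulVec]
  rfl

theorem continuous_act : Continuous fun p : SO3 × S2 => p.1.act p.2 := by
  refine Continuous.subtype_mk (f := fun p : SO3 × S2 => WithLp.toLp 2 (p.1.1.mulVec p.2.1.ofLp))
    ?_ _
  refine (PiLp.continuous_toLp 2 _).comp ?_
  refine Continuous.matrix_mulVec (continuous_subtype_val.comp continuous_fst) ?_
  exact (PiLp.continuous_ofLp 2 _).comp (continuous_subtype_val.comp continuous_snd)

end SO3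

/-- The north pole. -/
def northPole : S2 := ⟨!₂[0, 0, 1], by simp [EuclideanSpace.norm_eq, Fin.sum_univ_three]⟩

theorem sum_sq_eq_one (n : S2) : n.1 0 ^ 2 + n.1 1 ^ 2 + n.1 2 ^ 2 = 1 := by
  have h := EuclideanSpace.real_norm_sq_eq n.1
  rw [norm_eq_of_mem_sphere n, Fin.sum_univ_three] at h
  linarith

theorem mem_S2_iff (v : E3) : v ∈ Metric.sphere (0 : E3) 1 ↔ v 0 ^ 2 + v 1 ^ 2 + v 2 ^ 2 = 1 := by
  rw [mem_sphere_zero_iff_norm, ← Fin.sum_univ_three (fun i => v i ^ 2),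
    ← EuclideanSpace.real_norm_sq_eq, pow_eq_one_iff_of_nonneg (norm_nonneg v) two_ne_zero]

namespace SO3

/-- Every point of the sphere can be rotated to the north pole. -/
theorem exists_act_eq_northPole (n : S2) : ∃ g : SO3, g.act n = northPole := by
  have hn := sum_sq_eq_one n
  set x := n.1 0 with hx
  set y := n.1 1 with hy
  set z := n.1 2 with hz
  have key : ∀ g : SO3, g.1.mulVec ![x, y, z] = ![0, 0, 1] → g.act n = northPole := by
    intro g hg
    apply Subtype.ext
    apply (WithLp.ofLp_injective 2)
    rw [act_ofLp]
    have : n.1.ofLp = ![x, y, z] := by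
      ext i
      fin_cases i <;> rfl
    rw [this, hg]
    rfl
  by_cases h : z = -1
  -- At the south pole the axis `n + e_z` of the generic case degenerates; a half-turn about the
  -- first axis serves instead.
  · refine ⟨mk !![1, 0, 0; 0, -1, 0; 0, 0, -1] ?_ ?_, key _ ?_⟩
    · ext i j
      fin_cases i <;> fin_cases j <;> simp [Matrix.mul_apply, Fin.sum_univ_three]
    · simp [Matrix.det_fin_three]
    · have hx0 : x = 0 := by nlinarith [sq_nonneg x, sq_nonneg y]
      have hy0 : y = 0 := by nlinarith [sq_nonneg x, sq_nonneg y]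
      ext i
      fin_cases i <;> simp [mk, Matrix.mulVec, dotProduct, Fin.sum_univ_three, h, hx0, hy0]
  · have hz1 : 1 + z ≠ 0 := fun h' => h (by linarith)
    have hzz : x ^ 2 = 1 - y ^ 2 - z ^ 2 := by linarith
    -- The half-turn about `u = n + e_z`, with matrix `2 u uᵀ / |u|² - 1` and `|u|² = 2 (1 + z)`; it
    -- exchanges `n` and the pole.
    refine ⟨mk !![x ^ 2 / (1 + z) - 1, x * y / (1 + z), x;
        x * y / (1 + z), y ^ 2 / (1 + z) - 1, y; x, y, z] ?_ ?_, key _ ?_⟩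
    · ext i j
      fin_cases i <;> fin_cases j <;>
        simp [Matrix.mul_apply, Fin.sum_univ_three] <;> field_simp <;> grind
    · rw [Matrix.det_fin_three]
      simp
      field_simp
      grind
    · ext i
      fin_cases i <;> simp [mk, Matrix.mulVec, dotProduct, Fin.sum_univ_three] <;> field_simp <;>
        grind

theorem exists_act_eq (n m : S2) : ∃ g : SO3, g.act n = m := by
  obtain ⟨g, hg⟩ := exists_act_eq_northPole n
  obtain ⟨h, hh⟩ := exists_act_eq_northPole m
  refine ⟨h⁻¹ * g, ?_⟩
  rw [act_mul, hg, ← hh, ← act_mul, inv_mul_cancel]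
  apply Subtype.ext
  apply (WithLp.ofLp_injective 2)
  rw [act_ofLp]
  exact Matrix.one_mulVec _

/-! ### Invariant integration on SO(3) and on the sphere -/

/-- A finite right-invariant measure on the rotation group. -/
def invariantMeasure : Measure SO3 := (Measure.haar (G := SO3)).inv

instance : invariantMeasure.IsMulRightInvariant := by
  unfold invariantMeasure; infer_instance

instance : IsFiniteMeasure invariantMeasure := by
  unfold invariantMeasure
  constructor
  rw [Measure.inv_apply, Set.inv_univ]
  exact isCompact_univ.measure_lt_top

theorem invariantMeasure_univ_ne_zero : invariantMeasure.real Set.univ ≠ 0 := by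
  rw [measureReal_ne_zero_iff]
  unfold invariantMeasure
  rw [Measure.inv_apply, Set.inv_univ]
  exact isOpen_univ.measure_ne_zero _ Set.univ_nonempty

end SO3

/-- The surface measure of the unit sphere. -/
abbrev surface : Measure S2 := (volume : Measure E3).toSphere

theorem continuous_rotate (R : E3 ≃ₗᵢ[ℝ] E3) : Continuous (rotate R) :=
  Continuous.subtype_mk (R.continuous.comp continuous_subtype_val) _

/-- The surface measure of a set is defined through the volume of the cone over it; the cone over a
preimage is the preimage of the cone, and linear isometries preserve volume. -/
theorem measurePreserving_rotate (R : E3 ≃ₗᵢ[ℝ] E3) :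
    MeasurePreserving (rotate R) surface surface := by
  refine ⟨(continuous_rotate R).measurable, ?_⟩
  ext s hs
  rw [Measure.map_apply (continuous_rotate R).measurable hs,
    Measure.toSphere_apply' _ ((continuous_rotate R).measurable hs), Measure.toSphere_apply' _ hs]
  congr 1
  refine Eq.trans ?_ (R.measurePreserving.measure_preimage_equiv (f := R.toMeasurableEquiv) _)
  congr 1
  ext v
  simp only [Set.mem_smul, Set.mem_image, Set.mem_preimage]
  constructor
  · rintro ⟨r, hr, _, ⟨n, hn, rfl⟩, rfl⟩
    exact ⟨r, hr, _, ⟨_, hn, rfl⟩, (map_smul R r n.1).symm⟩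
  · rintro ⟨r, hr, _, ⟨n, hn, rfl⟩, h⟩
    refine ⟨r, hr, _, ⟨rotate R.symm n, ?_, rfl⟩, ?_⟩
    · simpa [rotate] using hn
    · apply R.injective
      rw [map_smul]
      rw [← show R.toMeasurableEquiv v = R v from rfl, ← h]
      simp [rotate]

theorem integral_rotate (R : E3 ≃ₗᵢ[ℝ] E3) {g : S2 → ℂ} (hg : Continuous g) :
    ∫ n, g (rotate R n) ∂surface = ∫ n, g n ∂surface := by
  have h := measurePreserving_rotate R
  conv_rhs => rw [← h.map_eq]
  rw [integral_map h.measurable.aemeasurable hg.aestronglyMeasurable]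

/-- Integrals over the sphere are averages over the rotation group. -/
theorem integral_surface_eq {g : S2 → ℂ} (hg : Continuous g) (e : S2) :
    (SO3.invariantMeasure.real Set.univ : ℂ) * ∫ n, g n ∂surface =
      surface.real Set.univ * ∫ R : SO3, g (R.act e) ∂SO3.invariantMeasure := by
  have h1 : ∫ R : SO3, ∫ n, g (R.act n) ∂surface ∂SO3.invariantMeasure =
      (SO3.invariantMeasure.real Set.univ : ℂ) * ∫ n, g n ∂surface := by
    simp only [SO3.act, integral_rotate _ hg, integral_const, Complex.real_smul]
  have h2 : ∫ n, ∫ R : SO3, g (R.act n) ∂SO3.invariantMeasure ∂surface =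
      surface.real Set.univ * ∫ R : SO3, g (R.act e) ∂SO3.invariantMeasure := by
    have : ∀ n : S2, ∫ R : SO3, g (R.act n) ∂SO3.invariantMeasure =
        ∫ R : SO3, g (R.act e) ∂SO3.invariantMeasure := by
      intro n
      obtain ⟨S, hS⟩ := SO3.exists_act_eq n e
      -- The substitution `R ↦ R S` needs right invariance, which is why the Haar measure is
      -- inverted.
      rw [← integral_mul_right_eq_self _ S]
      simp only [SO3.act_mul, hS]
    simp only [this, integral_const, Complex.real_smul]
  rw [← h1, ← h2]
  refine integral_integral_swap_of_hasCompactSupport (f := fun (R : SO3) (n : S2) => g (R.act n))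
    (hg.comp SO3.continuous_act) ?_
  exact HasCompactSupport.of_compactSpace _

/-! ### Averages of isotropic forms over rotations about an axis -/

-- Among the exponents `k + 1` from 1 to `2 l + 1`, only `l + 1` is a multiple of the order of `ω`;
-- every other geometric sum vanishes.
open Finset in
theorem sum_primitiveRoot_pow_succ {l k : ℕ} {ω : ℂ} (hω : IsPrimitiveRoot ω (l + 1))
    (hk : k ≤ 2 * l) :
    ∑ j ∈ range (l + 1), (ω ^ j) ^ (k + 1) = if k = l then (l + 1 : ℂ) else 0 := by
  have hswap : ∀ j, (ω ^ j) ^ (k + 1) = (ω ^ (k + 1)) ^ j := fun j => by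
    rw [← pow_mul, ← pow_mul, mul_comm]
  simp only [hswap]
  split_ifs with h
  · subst h
    simp [hω.pow_eq_one]
  · have hne : ω ^ (k + 1) ≠ 1 := by
      intro h1
      obtain ⟨c, hc⟩ := (hω.pow_eq_one_iff_dvd _).1 h1
      have h0 : c ≠ 0 := by rintro rfl; omega
      have h2 : c ≠ 1 := by rintro rfl; omega
      have : 2 ≤ c := by omega
      nlinarith
    have h1 : (ω ^ (k + 1)) ^ (l + 1) = 1 := by
      rw [← pow_mul, mul_comm, pow_mul, hω.pow_eq_one, one_pow]
    have := mul_neg_geom_sum (ω ^ (k + 1)) (l + 1)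
    rw [h1, sub_self] at this
    exact (mul_eq_zero.1 this).resolve_left (sub_ne_zero.2 hne.symm)

/-- Under this condition `A + b ζ + c ζ⁻¹` equals `ζ⁻¹ (p ζ + q)²`, so its powers expand by the
binomial theorem. -/
theorem exists_sq_sq_mul {A b c : ℂ} (h : 4 * b * c = A ^ 2) :
    ∃ p q : ℂ, b = p ^ 2 ∧ c = q ^ 2 ∧ A = 2 * p * q := by
  obtain ⟨p, hp⟩ := IsAlgClosed.exists_pow_nat_eq b two_pos
  obtain ⟨q, hq⟩ := IsAlgClosed.exists_pow_nat_eq c two_pos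
  have : A ^ 2 = (2 * p * q) ^ 2 := by rw [← h, ← hp, ← hq]; ring
  rcases sq_eq_sq_iff_eq_or_eq_neg.1 this with h1 | h1
  · exact ⟨p, q, hp.symm, hq.symm, h1⟩
  · exact ⟨p, -q, hp.symm, by rw [neg_sq, hq], by rw [h1]; ring⟩

open Finset in
/-- The sum of `(A + b ζ + c ζ⁻¹) ^ l` over the `(l + 1)`-st roots of unity when
`4 b c = A ^ 2`. -/
theorem sum_pow_primitiveRoot {l : ℕ} {ω : ℂ} (hω : IsPrimitiveRoot ω (l + 1)) {A b c : ℂ}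
    (h : 4 * b * c = A ^ 2) :
    ∑ j ∈ range (l + 1), (A + b * ω ^ j + c * (ω ^ j)⁻¹) ^ l =
      (l + 1) * (l.centralBinom * (A / 2) ^ l) := by
  obtain ⟨p, q, rfl, rfl, rfl⟩ := exists_sq_sq_mul h
  have hω0 : ω ≠ 0 := hω.ne_zero (Nat.succ_ne_zero l)
  -- Since `ζ^(l+1) = 1`, the `l`-th power of `ζ⁻¹ (p ζ + q)²` is `ζ (p ζ + q)^(2l)`. Summing over
  -- `ζ` leaves only the middle binomial term.
  have key : ∀ j, (2 * p * q + p ^ 2 * ω ^ j + q ^ 2 * (ω ^ j)⁻¹) ^ l =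
      ∑ k ∈ range (2 * l + 1), (p ^ k * q ^ (2 * l - k) * (2 * l).choose k) * (ω ^ j) ^ (k + 1) := by
    intro j
    have h0 : ω ^ j ≠ 0 := pow_ne_zero _ hω0
    have h1 : (ω ^ j) ^ (l + 1) = 1 := by rw [← pow_mul, mul_comm, pow_mul, hω.pow_eq_one, one_pow]
    have h2 : ω ^ j * (2 * p * q + p ^ 2 * ω ^ j + q ^ 2 * (ω ^ j)⁻¹) = (p * ω ^ j + q) ^ 2 := by
      field_simp
      ring
    calc _ = ω ^ j * (ω ^ j * (2 * p * q + p ^ 2 * ω ^ j + q ^ 2 * (ω ^ j)⁻¹)) ^ l := by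
          rw [mul_pow, ← mul_assoc, ← pow_succ', h1, one_mul]
      _ = ω ^ j * (p * ω ^ j + q) ^ (2 * l) := by rw [h2, ← pow_mul]
      _ = _ := by
          rw [add_pow, mul_sum]
          refine sum_congr rfl fun k _ => ?_
          rw [mul_pow]
          ring
  simp only [key]
  rw [sum_comm]
  simp only [← mul_sum]
  rw [sum_congr rfl fun k hk => by
    rw [sum_primitiveRoot_pow_succ hω (Nat.lt_succ_iff.1 (mem_range.1 hk))]]
  simp only [mul_ite, mul_zero]
  rw [sum_ite_eq' (range (2 * l + 1)) l, if_pos (mem_range.2 (by omega)), Nat.centralBinom,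
    show 2 * l - l = l by omega, show 2 * p * q / 2 = p * q by ring, mul_pow]
  ring

/-- A point of the sphere as a complex vector. -/
def cvec (n : S2) : Fin 3 → ℂ := fun i => (n.1 i : ℂ)

theorem continuous_cvec : Continuous cvec :=
  continuous_pi fun i => Complex.continuous_ofReal.comp
    ((PiLp.continuous_apply 2 _ i).comp continuous_subtype_val)

namespace SO3

/-- A rotation matrix as a complex matrix. -/
def toComplex (g : SO3) : Matrix (Fin 3) (Fin 3) ℂ := g.1.map Complex.ofRealHom

theorem toComplex_mul (g h : SO3) : (g * h).toComplex = g.toComplex * h.toComplex :=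
  Matrix.map_mul

theorem cvec_act (g : SO3) (n : S2) : cvec (g.act n) = g.toComplex.mulVec (cvec n) := by
  ext i
  exact RingHom.map_mulVec Complex.ofRealHom g.1 n.1.ofLp i

theorem toComplex_mul_transpose (g : SO3) : g.toComplex * g.toComplex.transpose = 1 := by
  rw [toComplex, ← Matrix.transpose_map, ← Matrix.map_mul, mul_transpose_self]
  simp

theorem transpose_toComplex_mul (g : SO3) : g.toComplex.transpose * g.toComplex = 1 := by
  rw [toComplex, ← Matrix.transpose_map, ← Matrix.map_mul, transpose_mul_self]
  simp

theorem mulVec_dotProduct_mulVec (g : SO3) (v w : Fin 3 → ℂ) :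
    g.toComplex.mulVec v ⬝ᵥ g.toComplex.mulVec w = v ⬝ᵥ w := by
  rw [Matrix.dotProduct_mulVec, Matrix.vecMul_mulVec, transpose_toComplex_mul, Matrix.vecMul_one]

theorem vecMul_dotProduct_vecMul (g : SO3) (v w : Fin 3 → ℂ) :
    Matrix.vecMul v g.toComplex ⬝ᵥ Matrix.vecMul w g.toComplex = v ⬝ᵥ w := by
  rw [← Matrix.dotProduct_mulVec, ← Matrix.mulVec_transpose g.toComplex w, Matrix.mulVec_mulVec,
    toComplex_mul_transpose, Matrix.one_mulVec]

theorem continuous_toComplex : Continuous toComplex :=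
  continuous_subtype_val.matrix_map Complex.continuous_ofReal

/-- The rotation by `θ` about the third axis. -/
def rotZ (θ : ℝ) : SO3 :=
  mk !![Real.cos θ, -Real.sin θ, 0; Real.sin θ, Real.cos θ, 0; 0, 0, 1]
    (by
      have := Real.sin_sq_add_cos_sq θ
      ext i j
      fin_cases i <;> fin_cases j <;> simp [Matrix.mul_apply, Fin.sum_univ_three] <;> grind)
    (by
      have := Real.sin_sq_add_cos_sq θ
      simp [Matrix.det_fin_three]
      grind)

theorem rotZ_northPole (θ : ℝ) : (rotZ θ).act northPole = northPole := by
  apply Subtype.ext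
  apply (WithLp.ofLp_injective 2)
  rw [act_ofLp]
  ext i
  fin_cases i <;>
    simp [rotZ, mk, northPole, Matrix.mulVec, dotProduct, Fin.sum_univ_three]

theorem dotProduct_rotZ_mulVec (θ : ℝ) (a w : Fin 3 → ℂ) :
    a ⬝ᵥ (rotZ θ).toComplex.mulVec w =
      a 2 * w 2 + (a 0 - Complex.I * a 1) * (w 0 + Complex.I * w 1) / 2 *
        Complex.exp (θ * Complex.I) + (a 0 + Complex.I * a 1) * (w 0 - Complex.I * w 1) / 2 *
          (Complex.exp (θ * Complex.I))⁻¹ := by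
  rw [← Complex.exp_neg, ← neg_mul, Complex.exp_mul_I, Complex.exp_mul_I, Complex.cos_neg,
    Complex.sin_neg]
  simp [rotZ, mk, toComplex, Matrix.mulVec, dotProduct, Fin.sum_univ_three]
  ring_nf
  simp only [Complex.I_sq]
  ring

open Finset in
/-- The sum of a power of a bilinear form over rotations about the third axis. -/
theorem sum_rotZ_pow {l : ℕ} {a w : Fin 3 → ℂ} (ha : a ⬝ᵥ a = 0) (hw : w ⬝ᵥ w = 0) :
    ∑ j ∈ range (l + 1),
      (a ⬝ᵥ (rotZ (j * (2 * Real.pi / (l + 1)))).toComplex.mulVec w) ^ l =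
      (l + 1) * (l.centralBinom * (a 2 * w 2 / 2) ^ l) := by
  simp only [dotProduct, Fin.sum_univ_three] at ha hw
  rw [← sum_pow_primitiveRoot (Complex.isPrimitiveRoot_exp (l + 1) l.succ_ne_zero)
    (b := (a 0 - Complex.I * a 1) * (w 0 + Complex.I * w 1) / 2)
    (c := (a 0 + Complex.I * a 1) * (w 0 - Complex.I * w 1) / 2)]
  · refine sum_congr rfl fun j _ => ?_
    rw [dotProduct_rotZ_mulVec, ← Complex.exp_nat_mul]
    push_cast
    rw [show (j : ℂ) * (2 * Real.pi / (l + 1)) * Complex.I =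
      j * (2 * Real.pi * Complex.I / (l + 1)) by ring]
  -- By isotropy, `(a 0² + a 1²)(w 0² + w 1²) = a 2² w 2²`, which is the condition `4 b c = A²`.
  · have hI := Complex.I_sq
    linear_combination (w 0 * w 0 + w 1 * w 1) * ha - a 2 * a 2 * hw +
      (-(a 1 ^ 2 * w 0 ^ 2) - w 1 ^ 2 * a 0 ^ 2 +
        a 1 ^ 2 * w 1 ^ 2 * (Complex.I ^ 2 - 1)) * hI

end SO3

/-! ### Orthogonality to powers of isotropic forms -/

/-- The rotation average of `F (g n) (v · g w) ^ l`. -/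
def pairing (F : S2 → ℂ) (l : ℕ) (v : Fin 3 → ℂ) (n : S2) (w : Fin 3 → ℂ) : ℂ :=
  ∫ g : SO3, F (g.act n) * (v ⬝ᵥ g.toComplex.mulVec w) ^ l ∂SO3.invariantMeasure

theorem continuous_pairing_integrand {F : S2 → ℂ} (hF : Continuous F) (l : ℕ) (v : Fin 3 → ℂ)
    (n : S2) (w : Fin 3 → ℂ) :
    Continuous fun g : SO3 => F (g.act n) * (v ⬝ᵥ g.toComplex.mulVec w) ^ l := by
  refine (hF.comp (SO3.continuous_act.comp (Continuous.prodMk_left n))).mul (Continuous.pow ?_ l)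
  exact continuous_const.dotProduct (SO3.continuous_toComplex.matrix_mulVec continuous_const)

theorem integrable_pairing_integrand {F : S2 → ℂ} (hF : Continuous F) (l : ℕ) (v : Fin 3 → ℂ)
    (n : S2) (w : Fin 3 → ℂ) :
    Integrable (fun g : SO3 => F (g.act n) * (v ⬝ᵥ g.toComplex.mulVec w) ^ l)
      SO3.invariantMeasure :=
  (continuous_pairing_integrand hF l v n w).integrable_of_hasCompactSupport
    (HasCompactSupport.of_compactSpace _)

theorem pairing_act (F : S2 → ℂ) (l : ℕ) (v : Fin 3 → ℂ) (n : S2) (w : Fin 3 → ℂ) (S : SO3) :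
    pairing F l v (S.act n) (S.toComplex.mulVec w) = pairing F l v n w := by
  unfold pairing
  rw [← integral_mul_right_eq_self (fun g : SO3 => F (g.act n) * (v ⬝ᵥ g.toComplex.mulVec w) ^ l) S]
  simp only [SO3.act_mul, SO3.toComplex_mul, Matrix.mulVec_mulVec]

-- Rotations about the third axis fix the pole, so `w` may be averaged over `l + 1` of them. The
-- averaged power factors into a part depending on `w` and the power `(v · g e_z)^l`.
open Finset in
theorem pairing_northPole {F : S2 → ℂ} (hF : Continuous F) (l : ℕ) {v w : Fin 3 → ℂ}
    (hv : v ⬝ᵥ v = 0) (hw : w ⬝ᵥ w = 0) :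
    pairing F l v northPole w =
      l.centralBinom * (w 2 / 2) ^ l * pairing F l v northPole (cvec northPole) := by
  have h1 : (l + 1 : ℂ) * pairing F l v northPole w = ∑ j ∈ range (l + 1),
      pairing F l v northPole
        ((SO3.rotZ (j * (2 * Real.pi / (l + 1)))).toComplex.mulVec w) := by
    rw [sum_congr rfl (fun j _ => by
      nth_rewrite 1 [← SO3.rotZ_northPole (j * (2 * Real.pi / (l + 1))), pairing_act]
      rfl)]
    simp
  have hl : (l + 1 : ℂ) ≠ 0 := Nat.cast_add_one_ne_zero l
  have h2 : ∑ j ∈ range (l + 1), pairing F l v northPole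
        ((SO3.rotZ (j * (2 * Real.pi / (l + 1)))).toComplex.mulVec w) =
      (l + 1) * (l.centralBinom * (w 2 / 2) ^ l * pairing F l v northPole (cvec northPole)) := by
    unfold pairing
    rw [← integral_finsetSum _ fun j _ => integrable_pairing_integrand hF l v _ _,
      ← integral_const_mul, ← integral_const_mul]
    refine integral_congr_ae (Filter.Eventually.of_forall fun g => ?_)
    simp only [← mul_sum, Matrix.dotProduct_mulVec v g.toComplex]
    rw [SO3.sum_rotZ_pow ((SO3.vecMul_dotProduct_vecMul g v v).trans hv) hw]
    have : Matrix.vecMul v g.toComplex ⬝ᵥ cvec northPole = Matrix.vecMul v g.toComplex 2 := by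
      simp [dotProduct, cvec, northPole, Fin.sum_univ_three]
    rw [this, div_pow, div_pow, mul_pow]
    ring
  rw [h2] at h1
  exact mul_left_cancel₀ hl h1

/-- The case of the pole carries over because rotating `n` and `w` together changes neither the
pairing nor `w · n`. -/
theorem pairing_eq {F : S2 → ℂ} (hF : Continuous F) (l : ℕ) {v w : Fin 3 → ℂ}
    (hv : v ⬝ᵥ v = 0) (hw : w ⬝ᵥ w = 0) (n : S2) :
    pairing F l v n w =
      l.centralBinom * (w ⬝ᵥ cvec n / 2) ^ l * pairing F l v northPole (cvec northPole) := by
  obtain ⟨S, hS⟩ := SO3.exists_act_eq_northPole n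
  rw [← pairing_act F l v n w S, hS, pairing_northPole hF l hv
    ((SO3.mulVec_dotProduct_mulVec S w w).trans hw), ← SO3.mulVec_dotProduct_mulVec S w (cvec n),
    ← SO3.cvec_act, hS]
  congr 4
  simp [dotProduct, cvec, northPole, Fin.sum_univ_three]

/-- The real-linear form `x ↦ w · x` on three-space. -/
def complexForm (w : Fin 3 → ℂ) : E3 →ₗ[ℝ] ℂ where
  toFun x := w ⬝ᵥ fun i => (x i : ℂ)
  map_add' x y := by
    simp only [dotProduct, Fin.sum_univ_three, PiLp.add_apply, Complex.ofReal_add]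
    ring
  map_smul' c x := by
    simp only [dotProduct, Fin.sum_univ_three, PiLp.smul_apply, smul_eq_mul, Complex.ofReal_mul,
      RingHom.id_apply, Complex.real_smul]
    ring

theorem complexForm_apply (w : Fin 3 → ℂ) (x : E3) :
    complexForm w x = w 0 * x 0 + w 1 * x 1 + w 2 * x 2 :=
  Fin.sum_univ_three fun i => w i * (x i : ℂ)

/-- Some point of the sphere is orthogonal to the real and the imaginary part of a vector. -/
theorem exists_dotProduct_cvec_eq_zero (w : Fin 3 → ℂ) : ∃ n : S2, w ⬝ᵥ cvec n = 0 := by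
  set f := complexForm w
  have hf : LinearMap.ker f ≠ ⊥ := by
    apply LinearMap.ker_ne_bot_of_finrank_lt
    rw [Complex.finrank_real_complex, finrank_euclideanSpace_fin]
    norm_num
  obtain ⟨x, hx, hx0⟩ := Submodule.exists_mem_ne_zero_of_ne_bot hf
  refine ⟨⟨‖x‖⁻¹ • x, by simp [norm_smul, hx0]⟩, ?_⟩
  have : f (‖x‖⁻¹ • x) = 0 := by rw [map_smul, LinearMap.mem_ker.1 hx, smul_zero]
  exact this

/-- The integral of a power of an isotropic linear form over the rotation group vanishes. -/
theorem integral_isotropic_pow {l : ℕ} (hl : 1 ≤ l) {v w : Fin 3 → ℂ}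
    (hv : v ⬝ᵥ v = 0) (hw : w ⬝ᵥ w = 0) (n : S2) :
    pairing (fun _ => 1) l v n w = 0 := by
  -- For the constant function the pairing does not see the point, so the point may be chosen with
  -- `w · m = 0`.
  obtain ⟨m, hm⟩ := exists_dotProduct_cvec_eq_zero w
  have : pairing (fun _ => 1) l v n w = pairing (fun _ => 1) l v m w := rfl
  rw [this, pairing_eq continuous_const l hv hw, hm, zero_div, zero_pow (by omega)]
  ring

/-- If the values of `F` at the rotated vectors of `V` have a constant sum, and the sum over `V` of
the `l`-th power of some isotropic linear form is nonzero, then `F` is orthogonal to all `l`-th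
powers of isotropic linear forms. -/
theorem integral_mul_isotropic_pow_eq_zero {V : Finset S2} {F : S2 → ℂ} (hF : Continuous F)
    (hV : ∀ g : SO3, ∑ n ∈ V, F (g.act n) = 1) {l : ℕ} (hl : 1 ≤ l) {w : Fin 3 → ℂ}
    (hw : w ⬝ᵥ w = 0) (hwV : ∑ n ∈ V, (w ⬝ᵥ cvec n) ^ l ≠ 0) {v : Fin 3 → ℂ}
    (hv : v ⬝ᵥ v = 0) : ∫ n, F n * (v ⬝ᵥ cvec n) ^ l ∂surface = 0 := by
  -- The sum of `F` over each rotated copy of `V` is 1, so the total is the pairing of the constant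
  -- function.
  have h1 : ∑ n ∈ V, pairing F l v n w = 0 := by
    rw [← integral_isotropic_pow hl hv hw northPole]
    unfold pairing
    rw [← integral_finsetSum _ fun n _ => integrable_pairing_integrand hF l v n w]
    simp only [← Finset.sum_mul, hV]
  simp only [pairing_eq hF l hv hw] at h1
  rw [← Finset.sum_mul, ← Finset.mul_sum] at h1
  simp only [div_pow] at h1
  rw [← Finset.sum_div] at h1
  have h2 : pairing F l v northPole (cvec northPole) = 0 := by
    refine (mul_eq_zero.1 h1).resolve_left (mul_ne_zero ?_ (div_ne_zero hwV (by simp)))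
    exact_mod_cast l.centralBinom_ne_zero
  have h3 := integral_surface_eq (g := fun n => F n * (v ⬝ᵥ cvec n) ^ l)
    (hF.mul ((continuous_const.dotProduct continuous_cvec).pow l)) northPole
  simp only [SO3.cvec_act] at h3
  rw [← pairing, h2, mul_zero] at h3
  refine (mul_eq_zero.1 h3).resolve_left ?_
  exact_mod_cast SO3.invariantMeasure_univ_ne_zero

/-- The integral of a power of an isotropic linear form over the sphere vanishes. -/
theorem integral_surface_isotropic_pow {l : ℕ} (hl : 1 ≤ l) {v : Fin 3 → ℂ} (hv : v ⬝ᵥ v = 0) :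
    ∫ n, (v ⬝ᵥ cvec n) ^ l ∂surface = 0 := by
  -- The constant function 1 satisfies the sum condition for a single point, and `(1, 0, i)` is
  -- isotropic with value `i ≠ 0` at the pole.
  simpa using integral_mul_isotropic_pow_eq_zero (V := {northPole}) (F := fun _ => 1)
    continuous_const (by simp) hl (w := ![1, 0, Complex.I])
    (by simp [dotProduct, Fin.sum_univ_three])
    (by simp [dotProduct, cvec, northPole, Fin.sum_univ_three]) hv

/-! ### Spherical harmonics from a generating polynomial -/

open Polynomial in
/-- The quadratic polynomial `(x - i y) + 2 z T - (x + i y) T ^ 2`, whose powers generate the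
spherical harmonics. -/
def genPoly (n : S2) : ℂ[X] :=
  C (cvec n 0 - Complex.I * cvec n 1) + C (2 * cvec n 2) * X -
    C (cvec n 0 + Complex.I * cvec n 1) * X ^ 2

-- Substituting `-u X` for `X` in the first quadratic gives `-u` times the second; comparing
-- coefficients and cancelling `(-u)^l` gives the identity. For `u = 0` nothing can be cancelled and
-- both sides are computed directly.
open Polynomial in
theorem coeff_taylor_pow_eq (u v z : ℂ) (huv : u = 0 → v = 0) (l m : ℕ) :
    (-u) ^ m * ((X ^ 2 + C (2 * z) * X - C (u * v)) ^ l).coeff (l + m) =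
      ((C v + C (2 * z) * X - C u * X ^ 2) ^ l).coeff (l + m) := by
  by_cases hu : u = 0
  · rw [huv hu, hu]
    have h1 : (X ^ 2 + C (2 * z) * X - C ((0 : ℂ) * 0)) ^ l = (X + C (2 * z)) ^ l * X ^ l := by
      rw [← mul_pow]
      congr 1
      simp
      ring
    have h2 : (C 0 + C (2 * z) * X - C (0 : ℂ) * X ^ 2) ^ l = C ((2 * z) ^ l) * X ^ l := by
      rw [C_pow, ← mul_pow]
      simp
    rw [h1, h2, add_comm l m, coeff_mul_X_pow, coeff_mul_X_pow]
    rcases Nat.eq_zero_or_pos m with rfl | hm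
    · simp [coeff_zero_eq_eval_zero]
    · rw [coeff_C, if_neg (by omega), neg_zero, zero_pow (by omega), zero_mul]
  · have h : ((X ^ 2 + C (2 * z) * X - C (u * v)) ^ l).comp (C (-u) * X) =
        C ((-u) ^ l) * (C v + C (2 * z) * X - C u * X ^ 2) ^ l := by
      rw [C_pow, ← mul_pow]
      simp
      ring
    have h' := congrArg (fun p => p.coeff (l + m)) h
    simp only [comp_C_mul_X_coeff, coeff_C_mul] at h'
    rw [pow_add] at h'
    apply mul_left_cancel₀ (pow_ne_zero l (neg_ne_zero.2 hu))
    rw [← h']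
    ring

theorem cvec_sum_sq (n : S2) : cvec n 0 ^ 2 + cvec n 1 ^ 2 + cvec n 2 ^ 2 = 1 := by
  have := congrArg Complex.ofReal (sum_sq_eq_one n)
  push_cast at this
  exact this

-- An iterated derivative at `z`, divided by the factorial, is a Taylor coefficient, and `(z + T)² -
-- 1 = T² + 2 z T - (1 - z²)`.
open Polynomial in
theorem ofReal_legendreFactor_eval (l m : ℕ) (z : ℝ) :
    (((legendreFactor l m).eval z : ℝ) : ℂ) = (-1) ^ m * (((l + m) ! / (2 ^ l * l ! : ℝ) : ℝ) : ℂ) *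
      ((X ^ 2 + C (2 * (z : ℂ)) * X - C (1 - (z : ℂ) ^ 2)) ^ l).coeff (l + m) := by
  have h1 : (derivative^[l + m] ((X ^ 2 - 1 : ℝ[X]) ^ l)).eval z =
      (l + m) ! * ((X ^ 2 + C (2 * z) * X - C (1 - z ^ 2)) ^ l).coeff (l + m) := by
    rw [← factorial_smul_hasseDeriv]
    rw [LinearMap.smul_apply, eval_smul, nsmul_eq_mul, ← taylor_coeff]
    congr 2
    simp only [taylor_pow, map_sub, taylor_X, taylor_one]
    congr 1
    simp only [map_mul, map_pow, map_one, map_ofNat]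
    ring
  have h2 : ((((X ^ 2 + C (2 * z) * X - C (1 - z ^ 2)) ^ l).coeff (l + m) : ℝ) : ℂ) =
      ((X ^ 2 + C (2 * (z : ℂ)) * X - C (1 - (z : ℂ) ^ 2)) ^ l).coeff (l + m) := by
    have := coeff_map Complex.ofRealHom (p := (X ^ 2 + C (2 * z) * X - C (1 - z ^ 2)) ^ l) (l + m)
    rw [Complex.ofRealHom_eq_coe] at this
    rw [← this]
    simp
  rw [legendreFactor, eval_mul, eval_C, h1, ← h2]
  push_cast
  ring

open Polynomial in
/-- The spherical harmonics are the coefficients of the powers of the generating polynomial. -/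
theorem exists_sphericalHarmonicNonneg_eq (l m : ℕ) : ∃ κ : ℝ, κ ≠ 0 ∧ ∀ n : S2,
    sphericalHarmonicNonneg l m n = κ * (genPoly n ^ l).coeff (l + m) := by
  refine ⟨Real.sqrt ((2 * (l : ℝ) + 1) / (4 * Real.pi) * (((l - m) ! : ℝ) / ((l + m) ! : ℝ))) *
    ((l + m) ! / (2 ^ l * l !)), by positivity, fun n => ?_⟩
  have huv : (cvec n 0 + Complex.I * cvec n 1) * (cvec n 0 - Complex.I * cvec n 1) =
      1 - cvec n 2 ^ 2 := by
    linear_combination cvec_sum_sq n - cvec n 1 ^ 2 * Complex.I_sq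
  have h0 : cvec n 0 + Complex.I * cvec n 1 = 0 → cvec n 0 - Complex.I * cvec n 1 = 0 := by
    intro h
    have := congrArg (starRingEnd ℂ) h
    simpa [cvec, sub_eq_add_neg] using this
  rw [genPoly, ← coeff_taylor_pow_eq _ _ _ h0, huv, sphericalHarmonicNonneg, Complex.ofReal_mul,
    ofReal_legendreFactor_eval,
    neg_pow (cvec n 0 + Complex.I * cvec n 1)]
  simp only [cvec]
  push_cast
  ring

theorem natDegree_genPoly_pow_lt (n : S2) (l : ℕ) : (genPoly n ^ l).natDegree < 2 * l + 1 := by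
  have h : (genPoly n).natDegree ≤ 2 := by
    unfold genPoly
    compute_degree
  have := Polynomial.natDegree_pow_le_of_le l h
  omega

theorem coeff_genPoly_pow_top (n : S2) (l : ℕ) :
    (genPoly n ^ l).coeff (l + l) = (-1) ^ l * (cvec n 0 + Complex.I * cvec n 1) ^ l := by
  have h : (genPoly n).natDegree ≤ 2 := by
    unfold genPoly
    compute_degree
  have h2 : (genPoly n).coeff 2 = -(cvec n 0 + Complex.I * cvec n 1) := by
    simp only [genPoly, Polynomial.coeff_sub, Polynomial.coeff_add, Polynomial.coeff_C_mul]
    simp [Polynomial.coeff_X]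
  rw [show l + l = l * 2 by omega, Polynomial.coeff_pow_of_natDegree_le h, h2, neg_pow]

/-- The linear form `x + i y`, as a vector. -/
def plusVec : Fin 3 → ℂ := ![1, Complex.I, 0]

theorem plusVec_isotropic : plusVec ⬝ᵥ plusVec = 0 := by
  simp [plusVec, dotProduct, Fin.sum_univ_three]

theorem plusVec_dotProduct (n : S2) :
    plusVec ⬝ᵥ cvec n = cvec n 0 + Complex.I * cvec n 1 := by
  simp [plusVec, dotProduct, Fin.sum_univ_three]

theorem exists_sphericalHarmonic_top (l : ℕ) : ∃ κ : ℝ, κ ≠ 0 ∧ ∀ n : S2,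
    sphericalHarmonic l l n = κ * (plusVec ⬝ᵥ cvec n) ^ l := by
  obtain ⟨κ, hκ, h⟩ := exists_sphericalHarmonicNonneg_eq l l
  refine ⟨κ * (-1) ^ l, by simp [hκ], fun n => ?_⟩
  rw [sphericalHarmonic, if_pos (by positivity), Int.natAbs_natCast, h, coeff_genPoly_pow_top,
    plusVec_dotProduct]
  push_cast
  ring

theorem continuous_coeff_genPoly_pow (l k : ℕ) :
    Continuous fun n => (genPoly n ^ l).coeff k := by
  have hc : ∀ i, Continuous fun n => cvec n i := fun i =>
    (continuous_apply i).comp continuous_cvec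
  induction l generalizing k with
  | zero => simp only [pow_zero]; exact continuous_const
  | succ l ih =>
    simp only [pow_succ, Polynomial.coeff_mul]
    refine continuous_finsetSum _ fun p _ => (ih p.1).mul ?_
    simp only [genPoly, Polynomial.coeff_add, Polynomial.coeff_sub, Polynomial.coeff_C_mul,
      Polynomial.coeff_C]
    split_ifs <;> have := hc 0 <;> have := hc 1 <;> have := hc 2 <;> fun_prop

theorem integrable_surface {g : S2 → ℂ} (hg : Continuous g) : Integrable g surface :=
  hg.integrable_of_hasCompactSupport (HasCompactSupport.of_compactSpace _)

/-- The coefficient vector is isotropic for every `t`, so powers of the generating polynomial take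
isotropic powers as values. -/
theorem eval_genPoly (n : S2) (t : ℂ) : (genPoly n).eval t =
    ![1 - t ^ 2, -Complex.I * (1 + t ^ 2), 2 * t] ⬝ᵥ cvec n := by
  simp [genPoly, dotProduct, Fin.sum_univ_three]
  ring

open Polynomial in
/-- A function orthogonal to all `l`-th powers of isotropic linear forms is orthogonal to all
coefficients of the `l`-th power of the generating polynomial. -/
theorem integral_mul_coeff_eq_zero {F : S2 → ℂ} (hF : Continuous F) {l : ℕ}
    (h : ∀ v : Fin 3 → ℂ, v ⬝ᵥ v = 0 → ∫ n, F n * (v ⬝ᵥ cvec n) ^ l ∂surface = 0)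
    {k : ℕ} (hk : k < 2 * l + 1) : ∫ n, F n * (genPoly n ^ l).coeff k ∂surface = 0 := by
  -- The integral of `F` against `genPoly n ^ l`, as a polynomial in the parameter. It vanishes at
  -- every `t`, hence coefficientwise.
  let P : ℂ[X] := ∑ j ∈ Finset.range (2 * l + 1),
    C (∫ n, F n * (genPoly n ^ l).coeff j ∂surface) * X ^ j
  have hP : P = 0 := by
    refine Polynomial.funext fun t => ?_
    have ht : (![1 - t ^ 2, -Complex.I * (1 + t ^ 2), 2 * t] : Fin 3 → ℂ) ⬝ᵥ
        ![1 - t ^ 2, -Complex.I * (1 + t ^ 2), 2 * t] = 0 := by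
      simp [dotProduct, Fin.sum_univ_three]
      linear_combination (1 + t ^ 2) ^ 2 * Complex.I_sq
    simp only [P, eval_finsetSum, eval_mul, eval_C, eval_pow, eval_X, eval_zero]
    rw [← h _ ht]
    simp only [← integral_mul_const]
    have hint : ∀ j ∈ Finset.range (2 * l + 1),
        Integrable (fun n => F n * (genPoly n ^ l).coeff j * t ^ j) surface := fun j _ =>
      integrable_surface ((hF.mul (continuous_coeff_genPoly_pow l j)).mul continuous_const)
    rw [← integral_finsetSum _ hint]
    refine integral_congr_ae (Filter.Eventually.of_forall fun n => ?_)
    simp only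
    rw [← eval_genPoly, ← eval_pow, eval_eq_sum_range' (natDegree_genPoly_pow_lt n l),
      Finset.mul_sum]
    exact Finset.sum_congr rfl fun j _ => by ring
  have := congrArg (fun p => p.coeff k) hP
  simpa [P, finsetSum_coeff, coeff_X_pow, hk] using this

/-- The case `m ≥ 0` is a coefficient of the generating polynomial. The conjugation in `c_{lm}` is
harmless because `F` is real; for `m < 0` it cancels the one in `Y_{lm}`. -/
theorem harmonicCoeff_eq_zero {F : S2 → ℝ} (hF : Continuous F) {l : ℕ}
    (h : ∀ v : Fin 3 → ℂ, v ⬝ᵥ v = 0 → ∫ n, (F n : ℂ) * (v ⬝ᵥ cvec n) ^ l ∂surface = 0)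
    {m : ℤ} (hm : -(l : ℤ) ≤ m) (hm' : m ≤ l) : harmonicCoeff F l m = 0 := by
  have hY : ∫ n, (F n : ℂ) * sphericalHarmonicNonneg l m.natAbs n ∂surface = 0 := by
    obtain ⟨κ, -, hκ⟩ := exists_sphericalHarmonicNonneg_eq l m.natAbs
    have := integral_mul_coeff_eq_zero (Complex.continuous_ofReal.comp hF) h
      (k := l + m.natAbs) (by omega)
    simp only [hκ, mul_left_comm _ (κ : ℂ), integral_const_mul]
    simp only [Function.comp_apply] at this
    rw [this, mul_zero]
  unfold harmonicCoeff sphericalHarmonic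
  split_ifs
  · rw [← map_zero (starRingEnd ℂ), ← hY, ← integral_conj]
    refine integral_congr_ae (Filter.Eventually.of_forall fun n => ?_)
    simp [mul_comm]
  · rw [← mul_zero ((-1 : ℂ) ^ m.natAbs), ← hY, ← integral_const_mul]
    refine integral_congr_ae (Filter.Eventually.of_forall fun n => ?_)
    simp
    ring

/-! ### Excluded and allowed degrees of frame functions -/

/-- This lets any function on the sphere define values on effects, and keeps the effects of one
measurement distinct. -/
theorem effect_injective {N : ℕ} (hN : N ≠ 0) : Function.Injective (effect N) := by
  intro n m h
  have hN' : (N : ℂ)⁻¹ ≠ 0 := inv_ne_zero (Nat.cast_ne_zero.2 hN)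
  have h' := smul_right_injective Op hN' h
  have h00 := congrFun (congrFun h' 0) 0
  have h01 := congrFun (congrFun h' 0) 1
  have h10 := congrFun (congrFun h' 1) 0
  simp [pauliX, pauliY, pauliZ] at h00 h01 h10
  have hx : (n.1 0 : ℂ) = m.1 0 := by linear_combination (h01 + h10) / 2
  have hy : (n.1 1 : ℂ) = m.1 1 := by
    linear_combination Complex.I / 2 * (h01 - h10) +
      (n.1 1 - m.1 1 : ℂ) * Complex.I_sq
  apply Subtype.ext
  ext i
  fin_cases i
  · exact_mod_cast hx
  · exact_mod_cast hy
  · exact_mod_cast h00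

theorem rotate_injective (R : E3 ≃ₗᵢ[ℝ] E3) : Function.Injective (rotate R) := by
  intro n m h
  exact Subtype.ext (R.injective (congrArg Subtype.val h))

open Classical in
theorem sum_image_effect {M : Type*} [AddCommMonoid M] {V : Finset S2} (hV : V.Nonempty)
    (R : E3 ≃ₗᵢ[ℝ] E3) (f : Op → M) :
    ∑ E ∈ V.image (fun n => effect V.card (rotate R n)), f E =
      ∑ n ∈ V, f (effect V.card (rotate R n)) :=
  Finset.sum_image fun _ _ _ _ h =>
    rotate_injective R (effect_injective (Finset.card_ne_zero.2 hV) h)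

/-- A degree for which the sum of powers of some isotropic linear form is nonzero is not allowed. -/
theorem not_mem_allowedHarmonics {V : Finset S2} (hV : V.Nonempty) {l : ℕ} (hl : 1 ≤ l)
    {w : Fin 3 → ℂ} (hw : w ⬝ᵥ w = 0) (hwV : ∑ n ∈ V, (w ⬝ᵥ cvec n) ^ l ≠ 0) :
    l ∉ allowedHarmonics V := by
  classical
  rintro ⟨f, hf, hc, m, hm, hm', h⟩
  refine h (harmonicCoeff_eq_zero hc (fun v hv => ?_) hm hm')
  refine integral_mul_isotropic_pow_eq_zero (Complex.continuous_ofReal.comp hc) (fun g => ?_)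
    hl hw hwV hv
  have h1 := hf.2 _ ⟨g.toIsometry, g.det_toIsometry, rfl⟩
  rw [sum_image_effect hV] at h1
  simp only [Function.comp_apply, blochFunction, SO3.act]
  exact_mod_cast h1

open Classical in
/-- A nonnegative continuous function on the sphere, bounded by one, whose sum over each rotated
copy of `V` is one, is the Bloch function of a frame function. -/
theorem exists_isFrameFunction {V : Finset S2} (hV : V.Nonempty) {F : S2 → ℝ}
    (hF : ∀ n, F n ∈ Set.Icc (0 : ℝ) 1)
    (hs : ∀ R : E3 ≃ₗᵢ[ℝ] E3, ∑ n ∈ V, F (rotate R n) = 1) :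
    ∃ f, IsFrameFunction (restrictedPOVMs V) f ∧ blochFunction V.card f = F := by
  have hinj := effect_injective (Finset.card_ne_zero.2 hV)
  have hext : ∀ n, Function.extend (effect V.card) F 0 (effect V.card n) = F n :=
    fun n => hinj.extend_apply F 0 n
  -- The default value 0 is taken only at operators that occur in none of the measurements.
  refine ⟨Function.extend (effect V.card) F 0, ⟨?_, ?_⟩, funext hext⟩
  · rintro X ⟨R, -, rfl⟩ E hE
    obtain ⟨n, -, rfl⟩ := Finset.mem_image.1 hE
    rw [hext]
    exact hF _
  · rintro X ⟨R, -, rfl⟩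
    rw [sum_image_effect hV]
    simp only [hext, hs]

theorem norm_plusVec_le (n : S2) : ‖plusVec ⬝ᵥ cvec n‖ ≤ 1 := by
  have h : ‖plusVec ⬝ᵥ cvec n‖ ^ 2 ≤ 1 := by
    rw [plusVec_dotProduct, ← Complex.normSq_eq_norm_sq, Complex.normSq_apply]
    have := sum_sq_eq_one n
    simp [cvec]
    nlinarith [sq_nonneg (n.1 2)]
  exact (sq_le_one_iff₀ (norm_nonneg _)).1 h

theorem continuous_plusVec_pow (l : ℕ) : Continuous fun n => (plusVec ⬝ᵥ cvec n) ^ l :=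
  (continuous_const.dotProduct continuous_cvec).pow l

theorem integral_re_plusVec_pow_sq_pos (l : ℕ) :
    0 < ∫ n, ((plusVec ⬝ᵥ cvec n) ^ l).re ^ 2 ∂surface := by
  have hc : Continuous fun n => ((plusVec ⬝ᵥ cvec n) ^ l).re ^ 2 :=
    (Complex.continuous_re.comp (continuous_plusVec_pow l)).pow 2
  refine hc.integral_pos_of_hasCompactSupport_nonneg_nonzero
    (HasCompactSupport.of_compactSpace _) (fun n => sq_nonneg _)
    (x := ⟨!₂[1, 0, 0], by simp [EuclideanSpace.norm_eq, Fin.sum_univ_three]⟩) ?_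
  simp [plusVec, cvec, dotProduct, Fin.sum_univ_three]

/-- If the real part of `(x + i y) ^ l` sums to zero over all rotated copies of `V`, then the degree
`l` is allowed. -/
theorem mem_allowedHarmonics {V : Finset S2} (hV : 2 ≤ V.card) {l : ℕ} (hl : 1 ≤ l)
    (h : ∀ R : E3 ≃ₗᵢ[ℝ] E3, ∑ n ∈ V, ((plusVec ⬝ᵥ cvec (rotate R n)) ^ l).re = 0) :
    l ∈ allowedHarmonics V := by
  have hV' : V.Nonempty := Finset.card_pos.1 (by omega)
  have hN : (0 : ℝ) < V.card := by positivity
  have hN2 : (2 : ℝ) ≤ V.card := by exact_mod_cast hV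
  have hre : ∀ n, |((plusVec ⬝ᵥ cvec n) ^ l).re| ≤ 1 := fun n =>
    (Complex.abs_re_le_norm _).trans (by
      rw [norm_pow]; exact pow_le_one₀ (norm_nonneg _) (norm_plusVec_le n))
  have hcr : Continuous fun n => ((plusVec ⬝ᵥ cvec n) ^ l).re :=
    Complex.continuous_re.comp (continuous_plusVec_pow l)
  -- The perturbation is bounded by 1, so the values lie in `[0, 2/N]`; `N ≥ 2` keeps them at most
  -- 1.
  obtain ⟨f, hf, hfF⟩ := exists_isFrameFunction hV'
    (F := fun n => (1 + ((plusVec ⬝ᵥ cvec n) ^ l).re) / V.card)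
    (fun n => by
      have := abs_le.1 (hre n)
      exact ⟨div_nonneg (by linarith) hN.le, (div_le_one hN).2 (by linarith)⟩)
    (fun R => by
      rw [← Finset.sum_div, Finset.sum_add_distrib, h]
      simp [hN.ne'])
  refine ⟨f, hf, ?_, l, by omega, le_rfl, ?_⟩
  · rw [hfF]
    exact (continuous_const.add hcr).div_const _
  · rw [hfF]
    obtain ⟨κ, hκ, hY⟩ := exists_sphericalHarmonic_top l
    have hcu : Continuous fun n => conj ((plusVec ⬝ᵥ cvec n) ^ l) :=
      Complex.continuous_conj.comp (continuous_plusVec_pow l)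
    have hcv : Continuous fun n =>
        conj ((plusVec ⬝ᵥ cvec n) ^ l) * (((plusVec ⬝ᵥ cvec n) ^ l).re : ℂ) :=
      hcu.mul (Complex.continuous_ofReal.comp hcr)
    have h1 : harmonicCoeff (fun n => (1 + ((plusVec ⬝ᵥ cvec n) ^ l).re) / V.card) l l =
        κ / V.card *
          ∫ n, conj ((plusVec ⬝ᵥ cvec n) ^ l) * (((plusVec ⬝ᵥ cvec n) ^ l).re : ℂ) ∂surface := by
      -- The constant part of `F` contributes nothing to the coefficient. What remains has real part
      -- `∫ (Re (x + i y)^l)² > 0`.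
      have h0 : ∫ n, conj ((plusVec ⬝ᵥ cvec n) ^ l) ∂surface = 0 := by
        rw [integral_conj, integral_surface_isotropic_pow hl plusVec_isotropic, map_zero]
      rw [← zero_add (∫ n, conj ((plusVec ⬝ᵥ cvec n) ^ l) *
        (((plusVec ⬝ᵥ cvec n) ^ l).re : ℂ) ∂surface), ← h0,
        ← integral_add (integrable_surface hcu) (integrable_surface hcv), ← integral_const_mul]
      refine integral_congr_ae (Filter.Eventually.of_forall fun n => ?_)
      simp only [hY]
      push_cast
      simp only [map_mul, Complex.conj_ofReal]
      ring
    rw [h1]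
    refine mul_ne_zero (div_ne_zero (by exact_mod_cast hκ) (by exact_mod_cast hN.ne')) fun h2 => ?_
    have h3 := congrArg Complex.re h2
    rw [← Complex.reCLM_apply, ← Complex.reCLM.integral_comp_comm (integrable_surface hcv)] at h3
    have h4 := integral_re_plusVec_pow_sq_pos l
    simp only [Complex.reCLM_apply, Complex.mul_re, Complex.conj_re, Complex.ofReal_re,
      Complex.ofReal_im, mul_zero, sub_zero, Complex.zero_re, ← sq] at h3
    exact h4.ne' h3

theorem zero_mem_allowedHarmonics {V : Finset S2} (hV : V.Nonempty) : 0 ∈ allowedHarmonics V := by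
  have hN : (0 : ℝ) < V.card := by exact_mod_cast Finset.card_pos.2 hV
  have hN1 : (1 : ℝ) ≤ V.card := by exact_mod_cast Finset.card_pos.2 hV
  obtain ⟨f, hf, hfF⟩ := exists_isFrameFunction hV (F := fun _ => (V.card : ℝ)⁻¹)
    (fun _ => ⟨by positivity, inv_le_one_of_one_le₀ hN1⟩) (fun R => by simp [hN.ne'])
  refine ⟨f, hf, hfF ▸ continuous_const, 0, by simp, by simp, ?_⟩
  obtain ⟨κ, hκ, hY⟩ := exists_sphericalHarmonic_top 0
  have hs : surface.real Set.univ ≠ 0 := by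
    rw [measureReal_ne_zero_iff]
    exact Measure.measure_univ_ne_zero.2 (Measure.toSphere_ne_zero _)
  simp only [Nat.cast_zero] at hY
  simp only [hfF, harmonicCoeff, hY, pow_zero, mul_one, integral_const, Complex.real_smul]
  simp only [Complex.conj_ofReal]
  exact_mod_cast mul_ne_zero hs (mul_ne_zero hκ (inv_ne_zero hN.ne'))

/-- An odd power changes sign under `n ↦ -n`, so the terms cancel in antipodal pairs. -/
theorem odd_mem_allowedHarmonics {V : Finset S2} (hV : V.Nonempty) (ha : IsAntipodal V) {l : ℕ}
    (hl : Odd l) : l ∈ allowedHarmonics V := by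
  have hne : ∀ n : S2, -n ≠ n := fun n hn => by
    have h := congrArg Subtype.val hn
    have h1 := norm_eq_of_mem_sphere n
    rw [coe_neg_sphere, neg_eq_iff_add_eq_zero, ← two_smul ℝ, smul_eq_zero_iff_right two_ne_zero] at h
    simp [h] at h1
  have hcard : 2 ≤ V.card := by
    obtain ⟨n, hn⟩ := hV
    exact Finset.one_lt_card.2 ⟨-n, ha n hn, n, hn, hne n⟩
  refine mem_allowedHarmonics hcard hl.pos fun R => ?_
  refine Finset.sum_involution (fun n _ => -n) (fun n _ => ?_) (fun n _ _ => hne n)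
    (fun n hn => ha n hn) (fun n _ => neg_neg n)
  have : plusVec ⬝ᵥ cvec (rotate R (-n)) = -(plusVec ⬝ᵥ cvec (rotate R n)) := by
    simp [plusVec_dotProduct, cvec, rotate]
    ring
  rw [this, hl.neg_pow]
  simp

theorem two_le_card {V : Finset S2} (hV : V.Nonempty) (h0 : ∑ n ∈ V, (n : E3) = 0) :
    2 ≤ V.card := by
  by_contra hlt
  have : V.card = 1 := by
    have := Finset.card_pos.2 hV
    omega
  obtain ⟨n, rfl⟩ := Finset.card_eq_one.1 this
  have h1 := norm_eq_of_mem_sphere n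
  rw [Finset.sum_singleton] at h0
  simp [h0] at h1

theorem sum_inner_sq {V : Finset S2} {c : ℝ}
    (hc : ∑ n ∈ V, Matrix.vecMulVec (n.1 : Fin 3 → ℝ) (n.1 : Fin 3 → ℝ) =
      c • (1 : Matrix (Fin 3) (Fin 3) ℝ)) (a : E3) :
    ∑ n ∈ V, inner ℝ n.1 a ^ 2 = c * ‖a‖ ^ 2 := by
  have h := congrArg (fun M : Matrix (Fin 3) (Fin 3) ℝ => a.ofLp ⬝ᵥ M.mulVec a.ofLp) hc
  simp only [Matrix.sum_mulVec, dotProduct_sum, Matrix.smul_mulVec, Matrix.one_mulVec,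
    dotProduct_smul, Matrix.vecMulVec_mulVec] at h
  rw [EuclideanSpace.real_norm_sq_eq]
  simp only [dotProduct, smul_eq_mul, ← sq] at h
  rw [← h]
  refine Finset.sum_congr rfl fun n _ => ?_
  simp [PiLp.inner_apply, Fin.sum_univ_three]
  ring

/-- The real part of `(x + i y)²` is `x² - y²`, and the squares of every coordinate have the same
sum `c` over each rotated copy of `V`. -/
theorem two_mem_allowedHarmonics {V : Finset S2} (hV : 2 ≤ V.card)
    (hp : ProjectorsSumToScalar V) : 2 ∈ allowedHarmonics V := by
  obtain ⟨c, hc⟩ := hp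
  refine mem_allowedHarmonics hV one_le_two fun R => ?_
  have hcoord : ∀ (n : S2) (i : Fin 3),
      (rotate R n).1 i = inner ℝ n.1 (R.symm (EuclideanSpace.single i 1)) := by
    intro n i
    rw [← R.inner_map_map, R.apply_symm_apply, EuclideanSpace.inner_single_right]
    simp [rotate]
  have hi : ∀ i : Fin 3, ∑ n ∈ V, (rotate R n).1 i ^ 2 = c := by
    intro i
    simp only [hcoord, sum_inner_sq hc]
    simp
  have : ∀ n ∈ V, ((plusVec ⬝ᵥ cvec (rotate R n)) ^ 2).re =
      (rotate R n).1 0 ^ 2 - (rotate R n).1 1 ^ 2 := by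
    intro n _
    simp [plusVec_dotProduct, cvec, sq]
  rw [Finset.sum_congr rfl this, Finset.sum_sub_distrib, hi, hi, sub_self]

/-- Rotated copies of a set of vectors with vanishing sum define POVMs. -/
theorem isPOVM_of_mem {V : Finset S2} (hV : V.Nonempty) (h0 : ∑ n ∈ V, (n : E3) = 0)
    {X : Finset Op} (hX : X ∈ restrictedPOVMs V) : IsPOVM X := by
  classical
  obtain ⟨R, -, rfl⟩ := hX
  refine ⟨fun E hE => ?_, ?_⟩
  · obtain ⟨n, -, rfl⟩ := Finset.mem_image.1 hE
    set m := rotate R n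
    have hm := cvec_sum_sq m
    simp only [cvec] at hm
    have hN : (0 : ℂ) ≤ (V.card : ℂ)⁻¹ * 2⁻¹ := by positivity
    -- For a unit vector, `A = 1 + m · σ` is Hermitian with `A² = 2 A`, so `A = A† A / 2` is
    -- positive.
    have : effect V.card m = ((V.card : ℂ)⁻¹ * 2⁻¹) •
        ((1 + (m.1 0 : ℂ) • pauliX + (m.1 1 : ℂ) • pauliY + (m.1 2 : ℂ) • pauliZ).conjTranspose *
          (1 + (m.1 0 : ℂ) • pauliX + (m.1 1 : ℂ) • pauliY + (m.1 2 : ℂ) • pauliZ)) := by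
      rw [effect, mul_smul]
      congr 1
      ext i j
      fin_cases i <;> fin_cases j <;>
        simp [pauliX, pauliY, pauliZ, Matrix.mul_apply, Fin.sum_univ_two] <;>
        grind [Complex.I_sq]
    rw [this]
    exact (Matrix.posSemidef_conjTranspose_mul_self _).smul hN
  · rw [sum_image_effect hV]
    have hR : ∀ i : Fin 3, ∑ n ∈ V, ((rotate R n).1 i : ℂ) = 0 := by
      intro i
      have h := congrArg (fun x : E3 => (R x) i) h0
      simp only [map_sum, map_zero, PiLp.zero_apply, WithLp.ofLp_sum, Finset.sum_apply] at h
      exact_mod_cast h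
    simp only [effect, ← Finset.smul_sum, Finset.sum_add_distrib, ← Finset.sum_smul, hR]
    have : (V.card : ℂ) ≠ 0 := by exact_mod_cast (Finset.card_ne_zero.2 hV)
    simp only [zero_smul, add_zero, Finset.sum_const, ← Nat.cast_smul_eq_nsmul ℂ, smul_smul,
      inv_mul_cancel₀ this, one_smul]

/-! ### Power sums over the vertices of octahedra and cubes -/

section Basis

variable (b : OrthonormalBasis (Fin 3) ℝ E3)

theorem inner_basis (i j : Fin 3) : inner ℝ (b i) (b j) = if i = j then (1 : ℝ) else 0 :=
  orthonormal_iff_ite.1 b.orthonormal i j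

theorem sum_basis_mul (j k : Fin 3) :
    b 0 j * b 0 k + b 1 j * b 1 k + b 2 j * b 2 k = if j = k then (1 : ℝ) else 0 := by
  have h := b.sum_inner_mul_inner (EuclideanSpace.single j (1 : ℝ)) (EuclideanSpace.single k 1)
  simp only [EuclideanSpace.inner_single_left, EuclideanSpace.inner_single_right,
    Fin.sum_univ_three, map_one, one_mul, PiLp.single_apply] at h
  simpa [eq_comm] using h

theorem basis_sum_mul (i j : Fin 3) :
    b i 0 * b j 0 + b i 1 * b j 1 + b i 2 * b j 2 = if i = j then (1 : ℝ) else 0 := by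
  rw [← inner_basis b, PiLp.inner_apply, Fin.sum_univ_three]
  simp [mul_comm]

/-- An isotropic linear form with prescribed values on an orthonormal basis. -/
theorem exists_isotropic (c : Fin 3 → ℂ) (hc : c 0 ^ 2 + c 1 ^ 2 + c 2 ^ 2 = 0) :
    ∃ w : Fin 3 → ℂ, w ⬝ᵥ w = 0 ∧ ∀ j, complexForm w (b j) = c j := by
  have hb : ∀ i j : Fin 3, (b i 0 * b j 0 + b i 1 * b j 1 + b i 2 * b j 2 : ℂ) =
      if i = j then 1 else 0 := fun i j => by
    have := congrArg Complex.ofReal (basis_sum_mul b i j)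
    rw [apply_ite Complex.ofReal] at this
    push_cast at this
    exact this
  have h00 := hb 0 0
  have h11 := hb 1 1
  have h22 := hb 2 2
  have h01 := hb 0 1
  have h02 := hb 0 2
  have h12 := hb 1 2
  simp at h00 h11 h22 h01 h02 h12
  refine ⟨fun k => c 0 * b 0 k + c 1 * b 1 k + c 2 * b 2 k, ?_, fun j => ?_⟩
  · simp only [dotProduct, Fin.sum_univ_three]
    linear_combination hc + c 0 ^ 2 * h00 + c 1 ^ 2 * h11 + c 2 ^ 2 * h22 +
      2 * c 0 * c 1 * h01 + 2 * c 0 * c 2 * h02 + 2 * c 1 * c 2 * h12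
  · rw [complexForm_apply]
    fin_cases j <;> simp only [Fin.zero_eta, Fin.mk_one, Fin.reduceFinMk]
    · linear_combination c 0 * h00 + c 1 * h01 + c 2 * h02
    · linear_combination c 0 * h01 + c 1 * h11 + c 2 * h12
    · linear_combination c 0 * h02 + c 1 * h12 + c 2 * h22

variable {b} {V : Finset S2}

theorem sum_octahedron {M : Type*} [AddCommMonoid M]
    (hb : ∀ n : S2, n ∈ V ↔ ∃ i, n.1 = b i ∨ n.1 = -b i) (f : E3 → M) :
    ∑ n ∈ V, f n.1 = ∑ i, (f (b i) + f (-b i)) := by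
  classical
  have hinj : Function.Injective fun p : Fin 3 × ℤˣ => ((p.2 : ℤ) : ℝ) • b p.1 := by
    rintro ⟨i, s⟩ ⟨j, t⟩ h
    have h' := congrArg (fun x => inner ℝ (b i) x) h
    simp only [inner_smul_right, inner_basis, if_true, mul_ite, mul_zero, mul_one] at h'
    split_ifs at h' with hij
    · subst hij
      have : s = t := Units.ext (by exact_mod_cast h')
      rw [this]
    · exact absurd h' (by simp)
  have himg : V.image Subtype.val =
      (Finset.univ : Finset (Fin 3 × ℤˣ)).image fun p => ((p.2 : ℤ) : ℝ) • b p.1 := by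
    ext v
    simp only [Finset.mem_image, Finset.mem_univ, true_and, Prod.exists]
    constructor
    · rintro ⟨n, hn, rfl⟩
      obtain ⟨i, h | h⟩ := (hb n).1 hn
      · exact ⟨i, 1, by simp [h]⟩
      · exact ⟨i, -1, by simp [h]⟩
    · rintro ⟨i, s, rfl⟩
      refine ⟨⟨((s : ℤ) : ℝ) • b i, ?_⟩, (hb _).2 ⟨i, ?_⟩, rfl⟩
      · rcases Int.units_eq_one_or s with rfl | rfl <;> simp
      · rcases Int.units_eq_one_or s with rfl | rfl <;> simp
  rw [← Finset.sum_image (f := f) (fun _ _ _ _ h => Subtype.ext h), himg,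
    Finset.sum_image (fun _ _ _ _ h => hinj h), Fintype.sum_prod_type]
  simp

theorem norm_cube_vertex {s : Fin 3 → ℝ} (hs : ∀ i, s i = 1 ∨ s i = -1) :
    (Real.sqrt 3)⁻¹ • ∑ i, s i • b i ∈ Metric.sphere (0 : E3) 1 := by
  have h : ‖∑ i, s i • b i‖ ^ 2 = 3 := by
    rw [← real_inner_self_eq_norm_sq, b.orthonormal.inner_sum]
    have : ∀ i, s i * s i = 1 := fun i => by rcases hs i with h | h <;> simp [h]
    simp [this]
  rw [mem_sphere_zero_iff_norm, norm_smul, norm_inv, Real.norm_of_nonneg (Real.sqrt_nonneg 3), ← h,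
    Real.sqrt_sq (norm_nonneg _)]
  exact inv_mul_cancel₀ fun h0 => by simp [h0] at h

/-- The vertex of the cube with the given signs. -/
def cubeVertex (b : OrthonormalBasis (Fin 3) ℝ E3) (s : Fin 3 → ℝ) : E3 :=
  (Real.sqrt 3)⁻¹ • (s 0 • b 0 + s 1 • b 1 + s 2 • b 2)

theorem sum_cube {M : Type*} [AddCommMonoid M]
    (hb : ∀ n : S2, n ∈ V ↔ ∃ s : Fin 3 → ℝ, (∀ i, s i = 1 ∨ s i = -1) ∧
      n.1 = (Real.sqrt 3)⁻¹ • ∑ i, s i • b i) (f : E3 → M) :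
    ∑ n ∈ V, f n.1 = ∑ p : ℤˣ × ℤˣ × ℤˣ,
      f (cubeVertex b ![((p.1 : ℤ) : ℝ), ((p.2.1 : ℤ) : ℝ), ((p.2.2 : ℤ) : ℝ)]) := by
  classical
  have hinj : Function.Injective fun p : ℤˣ × ℤˣ × ℤˣ =>
      cubeVertex b ![((p.1 : ℤ) : ℝ), ((p.2.1 : ℤ) : ℝ), ((p.2.2 : ℤ) : ℝ)] := by
    rintro ⟨s, t, u⟩ ⟨s', t', u'⟩ h
    have h3 : (Real.sqrt 3)⁻¹ ≠ 0 := by positivity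
    have h' := smul_right_injective E3 h3 h
    have h0 := congrArg (fun x => inner ℝ (b 0) x) h'
    have h1 := congrArg (fun x => inner ℝ (b 1) x) h'
    have h2 := congrArg (fun x => inner ℝ (b 2) x) h'
    simp [inner_add_right, inner_smul_right, Units.val_inj] at h0 h1 h2
    rw [h0, h1, h2]
  have hsgn : ∀ s : ℤˣ, ((s : ℤ) : ℝ) = 1 ∨ ((s : ℤ) : ℝ) = -1 := fun s => by
    rcases Int.units_eq_one_or s with rfl | rfl <;> simp
  have hex : ∀ x : ℝ, x = 1 ∨ x = -1 → ∃ s : ℤˣ, x = ((s : ℤ) : ℝ) := by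
    rintro x (rfl | rfl)
    · exact ⟨1, by simp⟩
    · exact ⟨-1, by simp⟩
  have himg : V.image Subtype.val = (Finset.univ : Finset (ℤˣ × ℤˣ × ℤˣ)).image fun p =>
      cubeVertex b ![((p.1 : ℤ) : ℝ), ((p.2.1 : ℤ) : ℝ), ((p.2.2 : ℤ) : ℝ)] := by
    ext v
    simp only [Finset.mem_image, Finset.mem_univ, true_and, Prod.exists]
    constructor
    · rintro ⟨n, hn, rfl⟩
      obtain ⟨s, hs, h⟩ := (hb n).1 hn
      obtain ⟨s0, h0⟩ := hex _ (hs 0)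
      obtain ⟨s1, h1⟩ := hex _ (hs 1)
      obtain ⟨s2, h2⟩ := hex _ (hs 2)
      refine ⟨s0, s1, s2, ?_⟩
      rw [h, Fin.sum_univ_three, cubeVertex, h0, h1, h2]
      rfl
    · rintro ⟨s, t, u, rfl⟩
      have hs : ∀ i, ![((s : ℤ) : ℝ), ((t : ℤ) : ℝ), ((u : ℤ) : ℝ)] i = 1 ∨
          ![((s : ℤ) : ℝ), ((t : ℤ) : ℝ), ((u : ℤ) : ℝ)] i = -1 := by
        intro i
        fin_cases i
        exacts [hsgn s, hsgn t, hsgn u]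
      refine ⟨⟨_, norm_cube_vertex (b := b) hs⟩, (hb _).2 ⟨_, hs, rfl⟩, ?_⟩
      simp only [Fin.sum_univ_three, cubeVertex]
  rw [← Finset.sum_image (f := f) (fun _ _ _ _ h => Subtype.ext h), himg,
    Finset.sum_image (fun _ _ _ _ h => hinj h)]

/-- For `l = 2 k` the sum is `2 (1 + 2 (-1/2)^k)`. It vanishes only if `(-1/2)^k = -1/2`, which
absolute values exclude for `k ≥ 2`. -/
theorem octahedron_sum_pow_ne_zero (hb : ∀ n : S2, n ∈ V ↔ ∃ i, n.1 = b i ∨ n.1 = -b i)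
    {L : E3 →ₗ[ℝ] ℂ} (h0 : L (b 0) = 1) (h1 : L (b 1) ^ 2 = -1 / 2) (h2 : L (b 2) ^ 2 = -1 / 2)
    {l : ℕ} (hl : Even l) (hl4 : 4 ≤ l) : ∑ n ∈ V, L n.1 ^ l ≠ 0 := by
  obtain ⟨k, rfl⟩ := hl
  rw [sum_octahedron hb fun v => L v ^ (k + k), Fin.sum_univ_three]
  simp only [map_neg, (Even.add_self k).neg_pow]
  rw [← two_mul k, pow_mul (L (b 1)), pow_mul (L (b 2)), h0, h1, h2, one_pow]
  intro h
  have h' : (-1 / 2 : ℝ) ^ k = -1 / 2 := by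
    have : ((-1 / 2 : ℂ)) ^ k = -1 / 2 := by linear_combination h / 4
    exact_mod_cast this
  have h3 := congrArg abs h'
  rw [abs_pow] at h3
  have : |(-1 / 2 : ℝ)| = 1 / 2 := by norm_num
  rw [this] at h3
  have h4 : (1 / 2 : ℝ) ^ k ≤ (1 / 2) ^ 2 :=
    pow_le_pow_of_le_one (by norm_num) (by norm_num) (by omega)
  rw [h3] at h4
  norm_num at h4

/-- The last two terms have absolute value at most `2 (7/9)^k`, which is below 1 from `k = 3` on.
For `k = 2` this bound is too weak, and `P^4 + conj P^4 = 2/81` is computed from the sum and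
product. -/
theorem cube_power_sum_ne_zero {P : ℂ} (hs : P + conj P = 2 / 3) (hp : P * conj P = 7 / 9)
    {k : ℕ} (hk : 2 ≤ k) : 1 + (1 / 9) ^ k + P ^ (2 * k) + conj P ^ (2 * k) ≠ 0 := by
  intro h
  rcases Nat.lt_or_ge 2 k with h3 | h3
  · have hP : ‖P‖ ^ 2 = 7 / 9 := by
      have := congrArg norm hp
      rw [norm_mul, RCLike.norm_conj, ← sq] at this
      rw [this]
      norm_num
    have h1 : ‖(1 + (1 / 9) ^ k : ℂ)‖ ≤ 2 * (7 / 9) ^ k := by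
      have : (1 + (1 / 9) ^ k : ℂ) = -(P ^ (2 * k) + conj P ^ (2 * k)) := by
        linear_combination h
      rw [this, norm_neg]
      refine (norm_add_le _ _).trans_eq ?_
      rw [norm_pow, norm_pow, RCLike.norm_conj, pow_mul, hP]
      ring
    have h2 : (1 : ℝ) ≤ ‖(1 + (1 / 9) ^ k : ℂ)‖ := by
      have : (1 + (1 / 9) ^ k : ℂ) = ((1 + (1 / 9) ^ k : ℝ) : ℂ) := by push_cast; rfl
      rw [this, Complex.norm_of_nonneg (by positivity)]
      have : (0 : ℝ) ≤ (1 / 9) ^ k := by positivity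
      linarith
    have h4 : (7 / 9 : ℝ) ^ k ≤ (7 / 9) ^ 3 :=
      pow_le_pow_of_le_one (by norm_num) (by norm_num) h3
    norm_num at h4
    linarith
  · obtain rfl : k = 2 := le_antisymm h3 hk
    have h2 : P ^ 2 + conj P ^ 2 = -10 / 9 := by
      linear_combination (P + conj P + 2 / 3) * hs - 2 * hp
    have h4 : P ^ 4 + conj P ^ 4 = 2 / 81 := by
      linear_combination (P ^ 2 + conj P ^ 2 - 10 / 9) * h2 - 2 * (P * conj P + 7 / 9) * hp
    have : (1 + (1 / 9) ^ 2 + 2 / 81 : ℂ) = 0 := by linear_combination h - h4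
    norm_num at this

/-- Up to sign, the form takes the values `1`, `1/3`, `P` and `conj P` on the four diagonals, with
`P = 1/3 + 2 i β / √3`. An even power sum is therefore twice the sum in `cube_power_sum_ne_zero`. -/
theorem cube_sum_pow_ne_zero (hb : ∀ n : S2, n ∈ V ↔ ∃ s : Fin 3 → ℝ, (∀ i, s i = 1 ∨ s i = -1) ∧
      n.1 = (Real.sqrt 3)⁻¹ • ∑ i, s i • b i)
    {L : E3 →ₗ[ℝ] ℂ} {β : ℝ} (hβ : β ^ 2 = 1 / 2) (h0 : L (b 0) = ((Real.sqrt 3)⁻¹ : ℝ))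
    (h1 : L (b 1) = ((Real.sqrt 3)⁻¹ : ℝ) + Complex.I * β)
    (h2 : L (b 2) = ((Real.sqrt 3)⁻¹ : ℝ) - Complex.I * β)
    {l : ℕ} (hl : Even l) (hl4 : 4 ≤ l) : ∑ n ∈ V, L n.1 ^ l ≠ 0 := by
  obtain ⟨k, rfl⟩ := hl
  rw [sum_cube hb fun v => L v ^ (k + k)]
  set α : ℝ := (Real.sqrt 3)⁻¹ with hα
  have hα2 : (α : ℂ) ^ 2 = 1 / 3 := by
    have : α ^ 2 = 1 / 3 := by rw [hα, inv_pow, Real.sq_sqrt (by norm_num)]; norm_num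
    have := congrArg Complex.ofReal this
    push_cast at this
    exact this
  have hβ2 : (β : ℂ) ^ 2 = 1 / 2 := by
    have := congrArg Complex.ofReal hβ
    push_cast at this
    exact this
  have hI := Complex.I_sq
  have hL : ∀ s : Fin 3 → ℝ, L (cubeVertex b s) =
      α * (s 0 * α + s 1 * (α + Complex.I * β) + s 2 * (α - Complex.I * β)) := by
    intro s
    simp only [cubeVertex, map_smul, map_add, h0, h1, h2, Complex.real_smul, ← hα]
  set P : ℂ := α * (α + 2 * (Complex.I * β)) with hP
  have hPc : conj P = α * (α - 2 * (Complex.I * β)) := by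
    simp only [hP, map_mul, map_add, Complex.conj_ofReal, Complex.conj_I, Complex.conj_ofNat]
    ring
  have key := cube_power_sum_ne_zero (P := P) (k := k)
    (by rw [hPc]; linear_combination 2 * hα2)
    (by
      rw [hPc]
      linear_combination (α ^ 2 + 1 / 3 + 2) * hα2 - 4 * α ^ 2 * β ^ 2 * hI + 4 * α ^ 2 * hβ2)
    (by omega)
  have e1 : L (cubeVertex b ![1, 1, 1]) = 1 := by
    rw [hL]; simp; linear_combination 3 * hα2
  have e2 : L (cubeVertex b ![1, 1, -1]) = P := by
    rw [hL, hP]; simp only [Matrix.cons_val]; push_cast; ring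
  have e3 : L (cubeVertex b ![1, -1, 1]) = conj P := by
    rw [hL, hPc]; simp only [Matrix.cons_val]; push_cast; ring
  have e4 : L (cubeVertex b ![1, -1, -1]) = -(1 / 3) := by
    rw [hL]; simp; linear_combination -hα2
  have hneg : ∀ x y z : ℝ, L (cubeVertex b ![-x, -y, -z]) = -L (cubeVertex b ![x, y, z]) := by
    intro x y z
    rw [hL, hL]; simp; ring
  have e5 := hneg 1 1 1
  have e6 := hneg 1 1 (-1)
  have e7 := hneg 1 (-1) 1
  have e8 := hneg 1 (-1) (-1)
  simp only [neg_neg] at e6 e7 e8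
  have h3 : ((1 : ℂ) / 3) ^ (k + k) = (1 / 9) ^ k := by
    rw [← two_mul, pow_mul]; norm_num
  rw [two_mul] at key
  simp only [Fintype.sum_prod_type, UnitsInt.univ, Finset.sum_pair (show (1 : ℤˣ) ≠ -1 by decide),
    Units.val_one, Units.val_neg, Int.cast_one, Int.cast_neg, e1, e2, e3, e4, e5, e6, e7, e8,
    (Even.add_self k).neg_pow, one_pow, h3]
  intro h
  exact key (by linear_combination h / 2)

/-- An octahedron consists of antipodal pairs, its vectors sum to zero and its projectors to a
multiple of the identity. -/
theorem octahedron_symmetry (hb : ∀ n : S2, n ∈ V ↔ ∃ i, n.1 = b i ∨ n.1 = -b i) :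
    V.Nonempty ∧ IsAntipodal V ∧ ∑ n ∈ V, (n : E3) = 0 ∧ ProjectorsSumToScalar V := by
  refine ⟨⟨⟨b 0, by simp⟩, (hb _).2 ⟨0, Or.inl rfl⟩⟩, fun n hn => ?_, ?_, 2, ?_⟩
  · obtain ⟨i, h | h⟩ := (hb n).1 hn
    · exact (hb _).2 ⟨i, Or.inr (by simp [h])⟩
    · exact (hb _).2 ⟨i, Or.inl (by simp [h])⟩
  · rw [sum_octahedron hb fun v => v]
    simp
  · rw [sum_octahedron hb fun v => Matrix.vecMulVec (v : Fin 3 → ℝ) (v : Fin 3 → ℝ)]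
    ext j k
    have h := sum_basis_mul b j k
    simp only [Fin.sum_univ_three, Matrix.add_apply, Matrix.vecMulVec_apply, Matrix.smul_apply,
      Matrix.one_apply, PiLp.neg_apply, smul_eq_mul, ← h]
    ring

/-- A cube consists of antipodal pairs, its vectors sum to zero and its projectors to a multiple of
the identity. -/
theorem cube_symmetry (hb : ∀ n : S2, n ∈ V ↔ ∃ s : Fin 3 → ℝ, (∀ i, s i = 1 ∨ s i = -1) ∧
      n.1 = (Real.sqrt 3)⁻¹ • ∑ i, s i • b i) :
    V.Nonempty ∧ IsAntipodal V ∧ ∑ n ∈ V, (n : E3) = 0 ∧ ProjectorsSumToScalar V := by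
  refine ⟨?_, fun n hn => ?_, ?_, 8 / 3, ?_⟩
  · have hs : ∀ i : Fin 3, (fun _ => (1 : ℝ)) i = 1 ∨ (fun _ => (1 : ℝ)) i = -1 :=
      fun _ => Or.inl rfl
    exact ⟨⟨_, norm_cube_vertex (b := b) hs⟩, (hb _).2 ⟨_, hs, rfl⟩⟩
  · obtain ⟨s, hs, h⟩ := (hb n).1 hn
    refine (hb _).2 ⟨fun i => -s i, fun i => ?_, ?_⟩
    · rcases hs i with h | h <;> simp [h]
    · simp [h]
  · rw [sum_cube hb fun v => v]
    simp only [Fintype.sum_prod_type, UnitsInt.univ,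
      Finset.sum_pair (show (1 : ℤˣ) ≠ -1 by decide), Units.val_one, Units.val_neg, Int.cast_one,
      Int.cast_neg, cubeVertex, Matrix.cons_val]
    module
  · rw [sum_cube hb fun v => Matrix.vecMulVec (v : Fin 3 → ℝ) (v : Fin 3 → ℝ)]
    ext j k
    have h := sum_basis_mul b j k
    have h3 : (Real.sqrt 3)⁻¹ ^ 2 = 1 / 3 := by
      rw [inv_pow, Real.sq_sqrt (by norm_num)]; norm_num
    simp only [Fintype.sum_prod_type, UnitsInt.univ,
      Finset.sum_pair (show (1 : ℤˣ) ≠ -1 by decide), Units.val_one, Units.val_neg, Int.cast_one,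
      Int.cast_neg, cubeVertex, Matrix.cons_val, Matrix.add_apply, Matrix.vecMulVec_apply,
      Matrix.smul_apply, Matrix.one_apply, PiLp.add_apply, PiLp.smul_apply, smul_eq_mul, ← h]
    linear_combination
      8 * (b 0 j * b 0 k + b 1 j * b 1 k + b 2 j * b 2 k) * h3

end Basis

/-! ### The allowed degrees for every octahedron and cube -/

/-- The allowed harmonics of a symmetric set for which all even degrees from four on are excluded by
isotropic linear forms. -/
theorem allowedHarmonics_eq {V : Finset S2} (hV : V.Nonempty) (ha : IsAntipodal V)
    (h0 : ∑ n ∈ V, (n : E3) = 0) (hp : ProjectorsSumToScalar V) {w : Fin 3 → ℂ} (hw : w ⬝ᵥ w = 0)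
    (hwV : ∀ l, Even l → 4 ≤ l → ∑ n ∈ V, complexForm w n.1 ^ l ≠ 0) :
    allowedHarmonics V = {l : ℕ | l = 0 ∨ l = 2 ∨ Odd l} := by
  ext l
  constructor
  · intro hl
    by_contra hne
    simp only [Set.mem_ofPred_eq, not_or, Nat.not_odd_iff_even] at hne
    obtain ⟨hl0, hl2, he⟩ := hne
    have hl4 : 4 ≤ l := by
      obtain ⟨k, rfl⟩ := he
      omega
    exact not_mem_allowedHarmonics hV (by omega) hw (hwV l he hl4) hl
  · rintro (rfl | rfl | h)
    · exact zero_mem_allowedHarmonics hV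
    · exact two_mem_allowedHarmonics (two_le_card hV h0) hp
    · exact odd_mem_allowedHarmonics hV ha h

theorem inv_sqrt_two_sq : (Real.sqrt 2)⁻¹ ^ 2 = 1 / 2 := by
  rw [inv_pow, Real.sq_sqrt (by norm_num), one_div]

theorem I_mul_inv_sqrt_two_sq : (Complex.I * ((Real.sqrt 2)⁻¹ : ℝ)) ^ 2 = -1 / 2 := by
  rw [mul_pow, Complex.I_sq, ← Complex.ofReal_pow, inv_sqrt_two_sq]
  norm_num

theorem inv_sqrt_three_sq : (Real.sqrt 3)⁻¹ ^ 2 = 1 / 3 := by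
  rw [inv_pow, Real.sq_sqrt (by norm_num), one_div]

theorem allowedHarmonics_octahedron_or_cube {V : Finset S2} (hV : IsOctahedron V ∨ IsCube V) :
    (∀ X ∈ restrictedPOVMs V, IsPOVM X) ∧ IsAntipodal V ∧ ProjectorsSumToScalar V ∧
      allowedHarmonics V = {l : ℕ | l = 0 ∨ l = 2 ∨ Odd l} := by
  rcases hV with ⟨b, hb⟩ | ⟨b, hb⟩
  · obtain ⟨hne, ha, h0, hp⟩ := octahedron_symmetry hb
    -- These are the values that `x + i y` takes on the axes of the fiducial octahedron; prescribing
    -- them on `b` avoids rotating `V`.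
    obtain ⟨w, hw, hc⟩ := exists_isotropic b
      ![1, Complex.I * ((Real.sqrt 2)⁻¹ : ℝ), Complex.I * ((Real.sqrt 2)⁻¹ : ℝ)]
      (by simp only [Matrix.cons_val]; rw [I_mul_inv_sqrt_two_sq]; norm_num)
    refine ⟨fun X hX => isPOVM_of_mem hne h0 hX, ha, hp,
      allowedHarmonics_eq hne ha h0 hp hw fun l he hl => ?_⟩
    refine octahedron_sum_pow_ne_zero hb (hc 0) ?_ ?_ he hl
    · rw [hc]; exact I_mul_inv_sqrt_two_sq
    · rw [hc]; exact I_mul_inv_sqrt_two_sq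
  · obtain ⟨hne, ha, h0, hp⟩ := cube_symmetry hb
    have h3 : (((Real.sqrt 3)⁻¹ : ℝ) : ℂ) ^ 2 = 1 / 3 := by
      rw [← Complex.ofReal_pow, inv_sqrt_three_sq]; norm_num
    -- The values of `x + i y` on the axes of the fiducial cube; their squares sum to `3 · 1/3 - 2 ·
    -- 1/2 = 0`.
    obtain ⟨w, hw, hc⟩ := exists_isotropic b
      ![((Real.sqrt 3)⁻¹ : ℝ), ((Real.sqrt 3)⁻¹ : ℝ) + Complex.I * ((Real.sqrt 2)⁻¹ : ℝ),
        ((Real.sqrt 3)⁻¹ : ℝ) - Complex.I * ((Real.sqrt 2)⁻¹ : ℝ)]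
      (by
        simp only [Matrix.cons_val]
        linear_combination 3 * h3 + 2 * I_mul_inv_sqrt_two_sq)
    refine ⟨fun X hX => isPOVM_of_mem hne h0 hX, ha, hp,
      allowedHarmonics_eq hne ha h0 hp hw fun l he hl => ?_⟩
    exact cube_sum_pow_ne_zero hb inv_sqrt_two_sq (hc 0) (hc 1) (hc 2) he hl

/-! ### The fiducial octahedron and cube -/

theorem exists_orthonormalBasis {v : Fin 3 → E3}
    (hv : ∀ i j, v i 0 * v j 0 + v i 1 * v j 1 + v i 2 * v j 2 = if i = j then 1 else 0) :
    ∃ b : OrthonormalBasis (Fin 3) ℝ E3, ∀ i, b i = v i := by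
  have ho : Orthonormal ℝ v := orthonormal_iff_ite.2 fun i j => by
    rw [← hv, PiLp.inner_apply, Fin.sum_univ_three]
    simp [mul_comm]
  exact ⟨(basisOfOrthonormalOfCardEqFinrank ho (by simp)).toOrthonormalBasis (by simpa using ho),
    fun i => by simp⟩

theorem exists_finset_of_subset_sphere {S : Set E3} (hS : S.Finite)
    (h : ∀ v ∈ S, v ∈ Metric.sphere (0 : E3) 1) :
    ∃ V : Finset S2, Subtype.val '' (V : Set S2) = S ∧ ∀ n : S2, n ∈ V ↔ n.1 ∈ S := by
  have hf : {n : S2 | n.1 ∈ S}.Finite := hS.preimage Subtype.val_injective.injOn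
  refine ⟨hf.toFinset, ?_, fun n => hf.mem_toFinset⟩
  rw [hf.coe_toFinset]
  ext v
  exact ⟨fun ⟨n, hn, hv⟩ => hv ▸ hn, fun hv => ⟨⟨v, h v hv⟩, hv, rfl⟩⟩

theorem sum_sphericalHarmonic_ne_zero {V : Finset S2} {l : ℕ}
    (h : ∑ n ∈ V, complexForm plusVec n.1 ^ l ≠ 0) : ∑ n ∈ V, sphericalHarmonic l l n ≠ 0 := by
  obtain ⟨κ, hκ, hY⟩ := exists_sphericalHarmonic_top l
  simp only [hY, ← Finset.mul_sum]
  exact mul_ne_zero (by exact_mod_cast hκ) h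

theorem complexForm_plusVec (x y z : ℝ) : complexForm plusVec (!₂[x, y, z]) = x + Complex.I * y := by
  simp [complexForm_apply, plusVec]

theorem exists_fiducialOctahedron : ∃ V : Finset S2,
    Subtype.val '' (V : Set S2) = fiducialOctahedron ∧ IsOctahedron V ∧
      ∀ l : ℕ, Even l → 4 ≤ l → ∑ n ∈ V, sphericalHarmonic l l n ≠ 0 := by
  have h2 := inv_sqrt_two_sq
  have hI := I_mul_inv_sqrt_two_sq
  have hS : fiducialOctahedron.Finite := by unfold fiducialOctahedron; exact Set.toFinite _
  have hmem : ∀ v : E3, v ∈ fiducialOctahedron ↔ v = !₂[1, 0, 0] ∨ v = !₂[-1, 0, 0] ∨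
      v = !₂[0, (Real.sqrt 2)⁻¹, (Real.sqrt 2)⁻¹] ∨ v = !₂[0, (Real.sqrt 2)⁻¹, -(Real.sqrt 2)⁻¹] ∨
      v = !₂[0, -(Real.sqrt 2)⁻¹, (Real.sqrt 2)⁻¹] ∨
      v = !₂[0, -(Real.sqrt 2)⁻¹, -(Real.sqrt 2)⁻¹] := fun v => Iff.rfl
  generalize (Real.sqrt 2)⁻¹ = r at h2 hmem hI
  obtain ⟨b, hb⟩ := exists_orthonormalBasis
    (v := ![!₂[1, 0, 0], !₂[0, r, r], !₂[0, r, -r]]) (by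
      intro i j
      fin_cases i <;> fin_cases j <;> simp <;> linear_combination 2 * h2)
  have hb0 : b 0 = !₂[1, 0, 0] := hb 0
  have hb1 : b 1 = !₂[0, r, r] := hb 1
  have hb2 : b 2 = !₂[0, r, -r] := hb 2
  obtain ⟨V, hV, hVS⟩ := exists_finset_of_subset_sphere hS (by
      intro v hv
      rw [mem_S2_iff]
      rw [hmem] at hv
      rcases hv with rfl | rfl | rfl | rfl | rfl | rfl <;> simp <;> linear_combination 2 * h2)
  have hVb : ∀ n : S2, n ∈ V ↔ ∃ i, n.1 = b i ∨ n.1 = -b i := by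
    intro n
    have e0 : -!₂[(1 : ℝ), 0, 0] = !₂[-1, 0, 0] := by ext i; fin_cases i <;> simp
    have e1 : -!₂[(0 : ℝ), r, r] = !₂[0, -r, -r] := by ext i; fin_cases i <;> simp
    have e2 : -!₂[(0 : ℝ), r, -r] = !₂[0, -r, r] := by ext i; fin_cases i <;> simp
    rw [hVS, hmem, Fin.exists_fin_succ, Fin.exists_fin_two, Fin.succ_zero_eq_one,
      Fin.succ_one_eq_two, hb0, hb1, hb2, e0, e1, e2]
    tauto
  refine ⟨V, hV, ⟨b, hVb⟩, fun l he hl => sum_sphericalHarmonic_ne_zero ?_⟩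
  refine octahedron_sum_pow_ne_zero hVb ?_ ?_ ?_ he hl
  · rw [hb0, complexForm_plusVec]; simp
  · rw [hb1, complexForm_plusVec, ← hI]; simp
  · rw [hb2, complexForm_plusVec, ← hI]; simp

theorem exists_fiducialCube : ∃ V : Finset S2,
    Subtype.val '' (V : Set S2) = fiducialCube ∧ IsCube V ∧
      ∀ l : ℕ, Even l → 4 ≤ l → ∑ n ∈ V, sphericalHarmonic l l n ≠ 0 := by
  have hq : Real.sqrt 2 = 2 * (Real.sqrt 2)⁻¹ := by
    have : Real.sqrt 2 ≠ 0 := by positivity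
    field_simp
    exact Real.sq_sqrt (by norm_num)
  have hst : Real.sqrt (2 / 3) = 2 * (Real.sqrt 2)⁻¹ * (Real.sqrt 3)⁻¹ := by
    rw [← hq, Real.sqrt_div (by norm_num), div_eq_mul_inv]
  have hmem : ∀ v : E3, v ∈ fiducialTetrahedron ↔ v = !₂[1, 0, 0] ∨
      v = !₂[-1 / 3, 0, -(2 * Real.sqrt 2 / 3)] ∨
      v = !₂[-1 / 3, Real.sqrt (2 / 3), Real.sqrt 2 / 3] ∨
      v = !₂[-1 / 3, -Real.sqrt (2 / 3), Real.sqrt 2 / 3] := fun v => Iff.rfl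
  have hS : fiducialCube.Finite := by
    have h1 : fiducialTetrahedron.Finite := by unfold fiducialTetrahedron; exact Set.toFinite _
    exact h1.union (h1.preimage neg_injective.injOn)
  have hr2 := inv_sqrt_two_sq
  have ha2 := inv_sqrt_three_sq
  obtain ⟨r, hr⟩ : ∃ r, r = (Real.sqrt 2)⁻¹ := ⟨_, rfl⟩
  obtain ⟨a, ha⟩ : ∃ a, a = (Real.sqrt 3)⁻¹ := ⟨_, rfl⟩
  rw [← hr] at hq hst hr2
  rw [← ha] at hst ha2
  rw [hst, hq] at hmem
  clear hst hq
  -- The axes of the cube, found as `√3/2` times the sum of the tetrahedron vertex `e_x` and each of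
  -- the other three.
  obtain ⟨b, hb⟩ := exists_orthonormalBasis
    (v := ![!₂[a, 0, -2 * r * a], !₂[a, r, r * a], !₂[a, -r, r * a]]) (by
      have hra : (r * a) ^ 2 = 1 / 6 := by rw [mul_pow, hr2, ha2]; norm_num
      intro i j
      fin_cases i <;> fin_cases j <;> simp <;> grind)
  have hb0 : b 0 = !₂[a, 0, -2 * r * a] := hb 0
  have hb1 : b 1 = !₂[a, r, r * a] := hb 1
  have hb2 : b 2 = !₂[a, -r, r * a] := hb 2
  have hv : ∀ x y z : ℝ, a • (x • b 0 + y • b 1 + z • b 2) =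
      !₂[(x + y + z) / 3, (y - z) * (r * a), (-2 * x + y + z) * r / 3] := by
    intro x y z
    rw [hb0, hb1, hb2]
    ext i
    fin_cases i <;> simp
    · linear_combination (x + y + z) * ha2
    · ring
    · linear_combination (-2 * x + y + z) * r * ha2
  -- The tetrahedron vertices are the cube vertices whose three signs have product `+1`; negation
  -- gives the other four.
  have ht0 : !₂[(1 : ℝ), 0, 0] = a • ((1 : ℝ) • b 0 + (1 : ℝ) • b 1 + (1 : ℝ) • b 2) := by
    rw [hv]; ext i; fin_cases i <;> simp <;> ring
  have ht1 : !₂[(-1 / 3 : ℝ), 0, -(2 * (2 * r) / 3)] =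
      a • ((1 : ℝ) • b 0 + (-1 : ℝ) • b 1 + (-1 : ℝ) • b 2) := by
    rw [hv]; ext i; fin_cases i <;> simp <;> ring
  have ht2 : !₂[(-1 / 3 : ℝ), 2 * r * a, 2 * r / 3] =
      a • ((-1 : ℝ) • b 0 + (1 : ℝ) • b 1 + (-1 : ℝ) • b 2) := by
    rw [hv]; ext i; fin_cases i <;> simp <;> ring
  have ht3 : !₂[(-1 / 3 : ℝ), -(2 * r * a), 2 * r / 3] =
      a • ((-1 : ℝ) • b 0 + (-1 : ℝ) • b 1 + (1 : ℝ) • b 2) := by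
    rw [hv]; ext i; fin_cases i <;> simp <;> ring
  rw [ht0, ht1, ht2, ht3] at hmem
  have hneg : ∀ x y z : ℝ, -(a • (x • b 0 + y • b 1 + z • b 2)) =
      a • ((-x) • b 0 + (-y) • b 1 + (-z) • b 2) := fun x y z => by module
  have hcube : ∀ v : E3, v ∈ fiducialCube ↔
      ∃ s : Fin 3 → ℝ, (∀ i, s i = 1 ∨ s i = -1) ∧ v = a • ∑ i, s i • b i := by
    intro v
    have key : v ∈ fiducialCube ↔ ∃ x y z : ℝ, (x = 1 ∨ x = -1) ∧ (y = 1 ∨ y = -1) ∧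
        (z = 1 ∨ z = -1) ∧ v = a • (x • b 0 + y • b 1 + z • b 2) := by
      rw [fiducialCube, Set.mem_ofPred_eq, hmem, hmem]
      simp only [neg_eq_iff_eq_neg (a := v), hneg, neg_neg]
      constructor
      · rintro ((h | h | h | h) | (h | h | h | h)) <;>
          exact ⟨_, _, _, by simp, by simp, by simp, h⟩
      · rintro ⟨x, y, z, rfl | rfl, rfl | rfl, rfl | rfl, h⟩ <;> simp only [h, true_or, or_true]
    rw [key]
    simp only [Fin.sum_univ_three]
    constructor
    · rintro ⟨x, y, z, hx, hy, hz, h⟩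
      refine ⟨![x, y, z], fun i => ?_, h⟩
      fin_cases i
      exacts [hx, hy, hz]
    · rintro ⟨s, hs, h⟩
      exact ⟨s 0, s 1, s 2, hs 0, hs 1, hs 2, h⟩
  obtain ⟨V, hV, hVS⟩ := exists_finset_of_subset_sphere hS (by
    intro v hv
    obtain ⟨s, hs, rfl⟩ := (hcube v).1 hv
    rw [ha]
    exact norm_cube_vertex hs)
  have hVb : ∀ n : S2, n ∈ V ↔ ∃ s : Fin 3 → ℝ, (∀ i, s i = 1 ∨ s i = -1) ∧
      n.1 = (Real.sqrt 3)⁻¹ • ∑ i, s i • b i := fun n => by rw [hVS, hcube, ha]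
  refine ⟨V, hV, ⟨b, hVb⟩, fun l he hl => sum_sphericalHarmonic_ne_zero ?_⟩
  refine cube_sum_pow_ne_zero hVb hr2 ?_ ?_ ?_ he hl
  · rw [hb0, complexForm_plusVec, ha]; simp
  · rw [hb1, complexForm_plusVec, ha]
  · rw [hb2, complexForm_plusVec, ha]; push_cast; ring

end QubitFrame

end

theorem mainTheorem7 :
    -- the allowed harmonics for every octahedron and every cube
    (∀ V : Finset QubitFrame.S2, QubitFrame.IsOctahedron V ∨ QubitFrame.IsCube V →
      (∀ X ∈ QubitFrame.restrictedPOVMs V, QubitFrame.IsPOVM X) ∧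
      QubitFrame.IsAntipodal V ∧
      QubitFrame.ProjectorsSumToScalar V ∧
      QubitFrame.allowedHarmonics V = {l : ℕ | l = 0 ∨ l = 2 ∨ Odd l}) ∧
    -- antipodal pairs make all odd harmonics allowed
    (∀ V : Finset QubitFrame.S2, V.Nonempty → QubitFrame.IsAntipodal V →
      ∀ l : ℕ, Odd l → l ∈ QubitFrame.allowedHarmonics V) ∧
    -- projectors that sum to a multiple of the identity make the harmonic of degree 2 allowed
    (∀ V : Finset QubitFrame.S2, V.Nonempty → ∑ n ∈ V, (n : QubitFrame.E3) = 0 →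
      QubitFrame.ProjectorsSumToScalar V → 2 ∈ QubitFrame.allowedHarmonics V) ∧
    -- a nonzero sum of the harmonics of degree l at the vectors rules out the degree l
    (∀ V : Finset QubitFrame.S2, V.Nonempty → ∑ n ∈ V, (n : QubitFrame.E3) = 0 →
      ∀ l : ℕ, 1 ≤ l → ∑ n ∈ V, QubitFrame.sphericalHarmonic l l n ≠ 0 →
      l ∉ QubitFrame.allowedHarmonics V) ∧
    -- the sums that rule out the even degrees from 4 on
    (∃ V : Finset QubitFrame.S2, Subtype.val '' (V : Set QubitFrame.S2) =
        QubitFrame.fiducialOctahedron ∧ QubitFrame.IsOctahedron V ∧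
      ∀ l : ℕ, Even l → 4 ≤ l → ∑ n ∈ V, QubitFrame.sphericalHarmonic l l n ≠ 0) ∧
    (∃ V : Finset QubitFrame.S2, Subtype.val '' (V : Set QubitFrame.S2) =
        QubitFrame.fiducialCube ∧ QubitFrame.IsCube V ∧
      ∀ l : ℕ, Even l → 4 ≤ l → ∑ n ∈ V, QubitFrame.sphericalHarmonic l l n ≠ 0) := by
  refine ⟨fun V hV => QubitFrame.allowedHarmonics_octahedron_or_cube hV,
    fun V hV ha l hl => QubitFrame.odd_mem_allowedHarmonics hV ha hl,
    fun V hV h0 hp => QubitFrame.two_mem_allowedHarmonics (QubitFrame.two_le_card hV h0) hp,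
    fun V hV _ l hl h => ?_, QubitFrame.exists_fiducialOctahedron,
    QubitFrame.exists_fiducialCube⟩
  refine QubitFrame.not_mem_allowedHarmonics hV hl QubitFrame.plusVec_isotropic fun h0 => h ?_
  obtain ⟨κ, -, hY⟩ := QubitFrame.exists_sphericalHarmonic_top l
  simp only [hY]
  rw [← Finset.mul_sum, h0, mul_zero]
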